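/- For elements $a,b$ of a group $G$ put $[a,b]=a^{-1}b^{-1}ab$, $[a,_0 b]=a$ and $[a,_n b]=[[a,_{n-1} b],b]$ for $n>0$. An element $x\in G$ is called right $n$-Engel if $[x,_n g]=1$ for all $g\in G$; the set of all right $n$-Engel elements of $G$ is denoted by $R_n(G)$. Let $\gamma_k(G)$ denote the $k$th term of the lower central series of $G$, so that $\gamma_1(G)=G$ and $\gamma_{k+1}(G)=[\gamma_k(G),G]$. Let $G$ be a group such that $\gamma_5(G)$ has no element of order $2$. Then $R_3(G)$ is a subgroup of $G$. In particular, $R_3(G)$ is a subgroup of $G$ whenever $G$ is a $2'$-group, that is, a group without elements of order $2$. -/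

import Mathlib

/-- The commutator `[a, b] = a⁻¹ b⁻¹ a b`. (Mathlib's `⁅a, b⁆` is `a b a⁻¹ b⁻¹`.) -/
def groupComm {G : Type*} [Group G] (a b : G) : G := a⁻¹ * b⁻¹ * a * b

/-- The `n`-Engel commutator: `[a,₀ b] = a` and `[a,ₙ₊₁ b] = [[a,ₙ b], b]`. -/
def engelComm {G : Type*} [Group G] : ℕ → G → G → G
  | 0, a, _ => a
  | n + 1, a, b => groupComm (engelComm n a b) b

/-- The set `R_n(G)` of right `n`-Engel elements of `G`. -/
def rightEngel (n : ℕ) (G : Type*) [Group G] : Set G :=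
  {x | ∀ g : G, engelComm n x g = 1}

/-- `S` is (the underlying set of) a subgroup of `G`. -/
def IsSubgroupSet {G : Type*} [Group G] (S : Set G) : Prop :=
  ∃ H : Subgroup G, (H : Set G) = S

/-- `G` is a `2'`-group: it has no element of order `2`. -/
def IsTwoPrimeGroup (G : Type*) [Group G] : Prop :=
  ∀ g : G, orderOf g ≠ 2

open scoped commutatorElement DirectSum

section Commutators

variable {G : Type*} [Group G]

theorem groupComm_eq_commutatorElement (a b : G) : groupComm a b = ⁅a⁻¹, b⁻¹⁆ := by
  simp [groupComm, commutatorElement_def]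

theorem groupComm_eq_one_iff {a b : G} : groupComm a b = 1 ↔ Commute a b := by
  rw [groupComm_eq_commutatorElement, commutatorElement_eq_one_iff_commute]
  simp

theorem mul_groupComm (a b : G) : a * groupComm a b = b⁻¹ * a * b := by
  simp [groupComm, mul_assoc]

theorem map_groupComm {K : Type*} [Group K] (φ : G →* K) (a b : G) :
    φ (groupComm a b) = groupComm (φ a) (φ b) := by
  simp [groupComm]

theorem conj_groupComm (a b g : G) :
    g⁻¹ * groupComm a b * g = groupComm (g⁻¹ * a * g) (g⁻¹ * b * g) := by
  simp only [groupComm]; group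

theorem groupComm_inv (a b : G) : (groupComm a b)⁻¹ = groupComm b a := by
  simp only [groupComm]; group

theorem mem_rightEngel_three_iff {x : G} :
    x ∈ rightEngel 3 G ↔
      ∀ g, Commute g ((groupComm x g)⁻¹ * g * groupComm x g) := by
  refine forall_congr' fun g => ?_
  show groupComm (groupComm (groupComm x g) g) g = 1 ↔ _
  rw [groupComm_eq_one_iff]
  generalize groupComm x g = t
  have h : groupComm t g = (t⁻¹ * g * t)⁻¹ * g := by simp only [groupComm]; group
  rw [h]
  constructor
  · intro h
    have h2 := (h.mul_left (Commute.refl g).inv_left).inv_left.symm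
    simpa [mul_assoc] using h2
  · intro h
    exact h.symm.inv_left.mul_left (Commute.refl g)

theorem rightEngel_conj {n : ℕ} {x : G} (hx : x ∈ rightEngel n G) (h : G) :
    h⁻¹ * x * h ∈ rightEngel n G := by
  intro g
  have key : ∀ n, ∀ g : G, engelComm n (h⁻¹ * x * h) g =
      h⁻¹ * engelComm n x (h * g * h⁻¹) * h := by
    intro n
    induction n with
    | zero => intro g; rfl
    | succ n ih =>
      intro g
      show groupComm (engelComm n _ g) g = h⁻¹ * groupComm (engelComm n x _) _ * h
      rw [ih, conj_groupComm]
      congr 1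
      group
  rw [key, hx]
  group

theorem map_engelComm {K : Type*} [Group K] (φ : G →* K) (n : ℕ) (x g : G) :
    φ (engelComm n x g) = engelComm n (φ x) (φ g) := by
  induction n with
  | zero => rfl
  | succ n ih =>
    show φ (groupComm _ _) = groupComm (engelComm n _ _) _
    rw [← ih, map_groupComm]

theorem rightEngel_map {n : ℕ} {K : Type*} [Group K] (φ : G →* K) (hφ : Function.Surjective φ)
    {x : G} (hx : x ∈ rightEngel n G) : φ x ∈ rightEngel n K := by
  intro g
  obtain ⟨g, rfl⟩ := hφ g
  rw [← map_engelComm, hx, map_one]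

theorem commute_of_eq_mul_inv {a b c : G} (hb : Commute a b) (hc : Commute a c) {d : G}
    (h : d = b * c⁻¹) : Commute a d := h ▸ hb.mul_right hc.inv_right

end Commutators

section EngelWords

variable {G : Type*} [Group G] {x : G}

/-- Multiplying `g` on the left by powers of `x` does not change `[x, g]`. -/
theorem groupComm_zpow_mul (x g : G) (i : ℤ) : groupComm x (x ^ i * g) = groupComm x g := by
  simp only [groupComm]; group

theorem rightEngel_commute_zpow_mul (hx : x ∈ rightEngel 3 G) (g : G) (i : ℤ) :
    Commute (x ^ i * g) ((groupComm x g)⁻¹ * (x ^ i * g) * groupComm x g) := by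
  have := mem_rightEngel_three_iff.1 hx (x ^ i * g)
  rwa [groupComm_zpow_mul] at this

theorem rightEngel_aux (hx : x ∈ rightEngel 3 G) (g : G) :
    let t := groupComm x g
    let X := t⁻¹ * x * t
    let c := t⁻¹ * g * t
    let m := x * (g * X * g⁻¹)
    c * x * c⁻¹ = X⁻¹ * m ∧ Commute m (X⁻¹ * x) := by
  intro t X c m
  have C0 : g * c = c * g := (mem_rightEngel_three_iff.1 hx g).eq
  have C1 : x * g * (X * c) = X * c * (x * g) := by
    have := (rightEngel_commute_zpow_mul hx g 1).eq
    simpa [X, c, t, mul_assoc] using this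
  have C2 : x * x * g * (X * X * c) = X * X * c * (x * x * g) := by
    have := (rightEngel_commute_zpow_mul hx g 2).eq
    rw [zpow_ofNat, pow_two] at this
    simpa [X, c, t, mul_assoc] using this
  have hc : g * c * g⁻¹ * c⁻¹ = 1 := by rw [C0]; group
  have h1 : c * x * c⁻¹ = X⁻¹ * m := by
    calc c * x * c⁻¹ = X⁻¹ * (X * c * (x * g)) * g⁻¹ * c⁻¹ := by group
      _ = X⁻¹ * (x * g * (X * c)) * g⁻¹ * c⁻¹ := by rw [C1]
      _ = X⁻¹ * x * (g * X * g⁻¹) * (g * c * g⁻¹ * c⁻¹) := by group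
      _ = X⁻¹ * m := by rw [hc]; simp only [m]; group
  have h2 : c * x * c⁻¹ * (c * x * c⁻¹) = X⁻¹ * X⁻¹ * x * m * x⁻¹ * m := by
    calc c * x * c⁻¹ * (c * x * c⁻¹) = X⁻¹ * X⁻¹ * (X * X * c * (x * x * g)) * g⁻¹ * c⁻¹ := by group
      _ = X⁻¹ * X⁻¹ * (x * x * g * (X * X * c)) * g⁻¹ * c⁻¹ := by rw [C2]
      _ = X⁻¹ * X⁻¹ * x * x * (g * X * X * g⁻¹) * (g * c * g⁻¹ * c⁻¹) := by group
      _ = _ := by rw [hc]; simp only [m]; group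
  refine ⟨h1, ?_⟩
  rw [h1] at h2
  have h3 : m * X⁻¹ = X⁻¹ * x * m * x⁻¹ := by
    have : X * (X⁻¹ * m * (X⁻¹ * m)) * m⁻¹ = X * (X⁻¹ * X⁻¹ * x * m * x⁻¹ * m) * m⁻¹ := by rw [h2]
    calc m * X⁻¹ = X * (X⁻¹ * m * (X⁻¹ * m)) * m⁻¹ := by group
      _ = _ := by rw [this]; group
  show m * (X⁻¹ * x) = X⁻¹ * x * m
  calc m * (X⁻¹ * x) = m * X⁻¹ * x := by group
    _ = _ := by rw [h3]; group

/-- `[x ^ g, x]` commutes with `x ^ (g⁻¹) * x`. -/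
theorem commute_groupComm_conj_mul (hx : x ∈ rightEngel 3 G) (g : G) :
    Commute (groupComm (g⁻¹ * x * g) x) (g * x * g⁻¹ * x) := by
  have h := (rightEngel_aux hx g).2.symm
  convert h using 1 <;> simp only [groupComm] <;> group

theorem commute_groupComm_zpow (hx : x ∈ rightEngel 3 G) (g : G) (i : ℤ) :
    Commute (groupComm (g⁻¹ * x * g) x) (x ^ i * (g * x * g⁻¹) * x ^ (1 - i)) := by
  have h := commute_groupComm_conj_mul hx (x ^ i * g)
  convert h using 1
  · congr 1; group
  · group

theorem rightEngel_conj_relation (hx : x ∈ rightEngel 3 G) (g : G) :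
    let p := g * x * g⁻¹
    let r := g⁻¹ * x * g
    r * (p * x) = x * x * p⁻¹ * x * p * x⁻¹ * p * x⁻¹ * r := by
  intro p r
  have h := (rightEngel_aux hx g).1
  calc r * (p * x) = x * r * (((groupComm x g)⁻¹ * x * groupComm x g)⁻¹ *
        (x * (g * ((groupComm x g)⁻¹ * x * groupComm x g) * g⁻¹))) := by
        simp only [p, r, groupComm]; group
    _ = _ := by rw [← h]; simp only [p, r, groupComm]; group

theorem rightEngel_recurrence (hx : x ∈ rightEngel 3 G) (g : G) :
    let p := g * x * g⁻¹
    let r := g⁻¹ * x * g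
    g⁻¹ * r * g = r * x⁻¹ * r * x⁻¹ * p * x⁻¹ * r := by
  intro p r
  have h : groupComm (groupComm (groupComm x g) g) g = 1 := hx g
  calc g⁻¹ * r * g = r * x⁻¹ * r * x⁻¹ * p * x⁻¹ * r *
        (g * groupComm (groupComm (groupComm x g) g) g * g⁻¹) := by
        simp only [p, r, groupComm]; group
    _ = _ := by rw [h]; group

end EngelWords

section LowerCentral

variable {G : Type*} [Group G]

theorem Subgroup.commutator_commutator_le_of_rotate {X Y Z N : Subgroup G} [N.Normal]
    (h1 : ⁅⁅Y, Z⁆, X⁆ ≤ N) (h2 : ⁅⁅Z, X⁆, Y⁆ ≤ N) : ⁅⁅X, Y⁆, Z⁆ ≤ N := by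
  have key : ∀ K : Subgroup G, K ≤ N ↔ K.map (QuotientGroup.mk' N) = ⊥ := by
    intro K
    rw [Subgroup.map_eq_bot_iff, QuotientGroup.ker_mk']
  rw [key] at *
  simp only [Subgroup.map_commutator] at *
  exact Subgroup.commutator_commutator_eq_bot_of_rotate h1 h2

variable (G) in
/-- The lower central series indexed from `1`; the terms of index `0` and `1` are the group. -/
def gam (n : ℕ) : Subgroup G := (⊤ : Subgroup G).lowerCentralSeries (n - 1)

instance gam_normal (n : ℕ) : (gam G n).Normal := by unfold gam; infer_instance

theorem gam_one : gam G 1 = ⊤ := rfl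

theorem mem_gam_one (x : G) : x ∈ gam G 1 := by rw [gam_one]; trivial

theorem gam_succ_succ (n : ℕ) : gam G (n + 2) = ⁅gam G (n + 1), ⊤⁆ := rfl

theorem gam_antitone : Antitone (gam G) := fun _ _ h =>
  Subgroup.lowerCentralSeries_antitone _ (Nat.sub_le_sub_right h 1)

theorem gam_le {m n : ℕ} (h : m ≤ n) {x : G} (hx : x ∈ gam G n) : x ∈ gam G m := gam_antitone h hx

theorem commutator_gam_le (i j : ℕ) : ⁅gam G i, gam G j⁆ ≤ gam G (i + j) := by
  rcases i with _ | i
  · rw [zero_add]; exact Subgroup.commutator_le_right _ _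
  rcases j with _ | j
  · exact Subgroup.commutator_le_left _ _
  induction j generalizing i with
  | zero => exact le_of_eq (gam_succ_succ i).symm
  | succ j ih =>
    rw [gam_succ_succ, Subgroup.commutator_comm]
    refine Subgroup.commutator_commutator_le_of_rotate ?_ ?_
    · rw [Subgroup.commutator_comm ⊤, ← gam_succ_succ]
      refine (ih (i + 1)).trans (le_of_eq ?_)
      congr 1; ring
    · refine (Subgroup.commutator_mono (ih i) le_rfl).trans (le_of_eq ?_)
      have : i + 1 + (j + 1) = (i + j + 1) + 1 := by ring
      rw [this, ← gam_succ_succ]; congr 1; ring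

theorem groupComm_mem_commutator {X Y : Subgroup G} {x y : G} (hx : x ∈ X) (hy : y ∈ Y) :
    groupComm x y ∈ ⁅X, Y⁆ := by
  rw [groupComm_eq_commutatorElement]
  exact Subgroup.commutator_mem_commutator (X.inv_mem hx) (Y.inv_mem hy)

theorem groupComm_mem_gam {i j : ℕ} {x y : G} (hx : x ∈ gam G i) (hy : y ∈ gam G j) :
    groupComm x y ∈ gam G (i + j) :=
  commutator_gam_le i j (groupComm_mem_commutator hx hy)

theorem groupComm_mem_gam_succ {i : ℕ} {x : G} (hx : x ∈ gam G i) (y : G) :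
    groupComm x y ∈ gam G (i + 1) := groupComm_mem_gam hx (mem_gam_one y)

theorem groupComm_conj_self (x g : G) :
    groupComm (g⁻¹ * x * g) x = groupComm (groupComm x g) x := by
  simp only [groupComm]; group

theorem groupComm_conj_self_mem (x g : G) : groupComm (g⁻¹ * x * g) x ∈ gam G 3 := by
  rw [groupComm_conj_self]
  exact groupComm_mem_gam_succ (groupComm_mem_gam_succ (mem_gam_one x) g) x

/-- `S` has no element of order `2`. -/
def TwoFree (S : Subgroup G) : Prop := ∀ u ∈ S, u ^ 2 = 1 → u = 1

theorem TwoFree.pow_four {S : Subgroup G} (hS : TwoFree S) {u : G} (hu : u ∈ S)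
    (h : u ^ 4 = 1) : u = 1 :=
  hS u hu (hS _ (S.pow_mem hu 2) (by rw [← pow_mul]; exact h))

theorem TwoFree.pow_two_pow {S : Subgroup G} (hS : TwoFree S) {u : G} (hu : u ∈ S) (k : ℕ)
    (h : u ^ 2 ^ k = 1) : u = 1 := by
  induction k with
  | zero => simpa using h
  | succ k ih => exact ih (hS _ (S.pow_mem hu _) (by rwa [← pow_mul, ← pow_succ]))

end LowerCentral

section Pairs

variable {G : Type*} [Group G]

/-- `[x ^ g, x]` commutes with `r³ x⁻¹ r x⁻³`, where `r = x ^ g`. -/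
theorem commute_groupComm_word {x : G} (hx : x ∈ rightEngel 3 G) (g : G) :
    Commute (groupComm (g⁻¹ * x * g) x)
      ((g⁻¹ * x * g) ^ 3 * x⁻¹ * (g⁻¹ * x * g) * x⁻¹ ^ 3) := by
  have hr := rightEngel_conj hx g
  have h1 := commute_groupComm_zpow hx g 2
  have h2 := commute_groupComm_zpow hr g⁻¹ 2
  have h3 := rightEngel_recurrence hx g
  simp only at h3
  have e1 : g⁻¹⁻¹ * (g⁻¹ * x * g) * g⁻¹ = x := by group
  rw [e1, inv_inv, h3, ← groupComm_inv] at h2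
  have h2' := h2.inv_left
  rw [inv_inv] at h2'
  refine commute_of_eq_mul_inv h2' h1 ?_
  generalize g⁻¹ * x * g = r
  group

/-- For two right 3-Engel elements `q`, `r`, the element `[q ^ r, q]` commutes with
`q`, `q ^ r` and `q ^ (r⁻¹)`. -/
theorem commute_groupComm_pair (hG : TwoFree (gam G 4)) {q r : G}
    (hq : q ∈ rightEngel 3 G) (hr : r ∈ rightEngel 3 G) :
    Commute (groupComm (r⁻¹ * q * r) q) q ∧ Commute (groupComm (r⁻¹ * q * r) q) (r⁻¹ * q * r) ∧
      Commute (groupComm (r⁻¹ * q * r) q) (r * q * r⁻¹) := by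
  have hf3 := groupComm_conj_self_mem q r
  have hw := commute_groupComm_word hq r
  have hp := commute_groupComm_conj_mul hq r
  have hE := mem_rightEngel_three_iff.1 hq (r⁻¹ * q * r)
  have h1 : Commute (groupComm (r⁻¹ * q * r) q) q := by
    have h := mem_rightEngel_three_iff.1 hr q
    have h2 : Commute q (groupComm r q * q * (groupComm r q)⁻¹) := by
      have := congrArg (fun z => groupComm r q * z * (groupComm r q)⁻¹) h.eq
      simp only [mul_assoc, mul_inv_cancel_left] at this
      show _ = _
      simp only [mul_assoc]
      simpa using this.symm
    have h3 := h2.symm.inv_left.mul_left (Commute.refl q)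
    have e : groupComm (r⁻¹ * q * r) q = (groupComm r q * q * (groupComm r q)⁻¹)⁻¹ * q := by
      simp only [groupComm]; group
    rwa [e]
  generalize hy : r⁻¹ * q * r = y at *
  set f := groupComm y q with hf
  have h2 : Commute f (y ^ 4) := by
    have e : y ^ 3 * q⁻¹ * y * q⁻¹ ^ 3 = y ^ 4 * f * q⁻¹ ^ 4 := by
      rw [hf]; simp only [groupComm]; group
    rw [e] at hw
    have h3 := (hw.mul_right (h1.inv_right.pow_right 4).inv_right).mul_right
      (Commute.refl f).inv_right
    simpa [mul_assoc] using h3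
  set k := groupComm f⁻¹ y with hk
  have hky : Commute k y := by
    have e : groupComm q y = f⁻¹ := (groupComm_inv _ _).symm
    rw [e, inv_inv] at hE
    have e3 : k = (f * y * f⁻¹)⁻¹ * y := by simp only [k, groupComm]; group
    rw [e3]
    exact hE.symm.inv_left.mul_left (Commute.refl y)
  have hk4 : k ^ 4 = 1 := by
    have e : f * y⁻¹ * f⁻¹ = k * y⁻¹ := by simp only [k, groupComm]; group
    have e2 : (f * y⁻¹ * f⁻¹) ^ 4 = y⁻¹ ^ 4 := by
      rw [conj_pow, inv_pow]
      have := h2.inv_right.eq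
      rw [this]; group
    rw [e, (hky.inv_right).mul_pow] at e2
    simpa using e2
  have hk1 : k = 1 := hG.pow_four
    (groupComm_mem_gam_succ (inv_mem hf3) _) hk4
  have hfy : Commute f y := by
    have := groupComm_eq_one_iff.1 hk1
    simpa using this.inv_left
  refine ⟨h1, hfy, ?_⟩
  have := hp.mul_right h1.inv_right
  simpa [mul_assoc] using this

end Pairs

section PairCentral

variable {G : Type*} [Group G]

theorem mul_eq_mul_assoc {a b c : G} (h : a * b = c) (z : G) : a * (b * z) = c * z := by
  rw [← mul_assoc, h]

theorem commute_conj {a b : G} (h : Commute a b) (g : G) :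
    Commute (g⁻¹ * a * g) (g⁻¹ * b * g) := by
  show _ = _
  calc _ = g⁻¹ * (a * b) * g := by group
    _ = _ := by rw [h.eq]; group

theorem mul_groupComm_right (e q : G) : e * q = q * (e * groupComm e q) := by
  simp only [groupComm]; group

/-- The subgroup generated by two right 3-Engel elements has class at most three. -/
theorem rightEngel_pair_central (hG : TwoFree (gam G 4)) {q r : G}
    (hq : q ∈ rightEngel 3 G) (hr : r ∈ rightEngel 3 G) :
    let e := groupComm r q
    let f := groupComm e q
    let k := groupComm e r
    Commute f q ∧ Commute f r ∧ Commute k q ∧ Commute k r := by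
  intro e f k
  obtain ⟨a1, a2, a3⟩ := commute_groupComm_pair hG hq hr
  obtain ⟨b1, b2, b3⟩ := commute_groupComm_pair hG hr hq
  have ek : groupComm (q⁻¹ * r * q) r = k := by simp only [k, e, groupComm]; group
  rw [ek] at b1 b2 b3
  have eqe : r⁻¹ * q * r = q * e⁻¹ := by simp only [e, groupComm]; group
  have ere : q⁻¹ * r * q = r * e := by simp only [e, groupComm]; group
  have hke : Commute k e := by
    rw [ere] at b2
    simpa using b1.inv_right.mul_right b2
  have hφe : Commute (groupComm (r⁻¹ * q * r) q) e := by
    have h := a1.inv_right.mul_right a2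
    rw [show q⁻¹ * (r⁻¹ * q * r) = e⁻¹ by rw [eqe]; group] at h
    simpa using h.inv_right
  have ef : groupComm (r⁻¹ * q * r) q = f⁻¹ := by
    have h1 : e⁻¹ * groupComm (r⁻¹ * q * r) q * e = f⁻¹ := by
      simp only [f, e, groupComm]; group
    rw [← h1, mul_assoc e⁻¹, hφe.eq, inv_mul_cancel_left]
  rw [ef] at a1 a2 a3 hφe
  have hfq : Commute f q := by simpa using a1.inv_left
  have hfq' : Commute f (r * q * r⁻¹) := by simpa using a3.inv_left
  have hfe : Commute f e := by simpa using hφe.inv_left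
  have heq : e * q = q * (e * f) := mul_groupComm_right e q
  have her : e * r = r * (e * k) := mul_groupComm_right e r
  have hrq : r * q = q * (r * e) := mul_groupComm_right r q
  have hek : r * e * r⁻¹ = e * k⁻¹ := by
    have h1 : r * e * r⁻¹ * k = e := by
      calc r * e * r⁻¹ * k = r * e * (r⁻¹ * k * r) * r⁻¹ := by group
        _ = r * (e * k) * r⁻¹ := by rw [mul_assoc r⁻¹, b1.eq]; group
        _ = e := by rw [← her]; group
    rw [eq_mul_inv_iff_mul_eq, h1]
  have hfe' : Commute f (r * e * r⁻¹) := by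
    have : r * e * r⁻¹ = q⁻¹ * (r * q * r⁻¹) := by simp only [e, groupComm]; group
    rw [this]; exact hfq.inv_right.mul_right hfq'
  have hfk : Commute f k := by
    rw [hek] at hfe'
    simpa using (hfe.inv_right.mul_right hfe').inv_right
  set F := r⁻¹ * f * r with hF
  set K := q⁻¹ * k * q with hK
  have hFq : Commute F q := by
    have := commute_conj hfq' r
    rwa [show r⁻¹ * (r * q * r⁻¹) * r = q by group] at this
  have hKr : Commute K r := by
    have := commute_conj b3 q
    rwa [show q⁻¹ * (q * r * q⁻¹) * q = r by group] at this
  have hFe : Commute F e := by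
    have := commute_conj hfe' r
    rwa [show r⁻¹ * (r * e * r⁻¹) * r = e by group] at this
  have hFK : f * K = k * F := by
    have h1 : (r * q)⁻¹ * e * (r * q) = e * (f * K) := by
      calc (r * q)⁻¹ * e * (r * q) = q⁻¹ * (r⁻¹ * (e * r)) * q := by group
        _ = q⁻¹ * (e * q) * (q⁻¹ * k * q) := by rw [her]; group
        _ = e * (f * K) := by rw [heq, hK]; group
    have h2 : (r * q)⁻¹ * e * (r * q) = e * (k * F) := by
      calc (r * q)⁻¹ * e * (r * q) = e⁻¹ * (r⁻¹ * (q⁻¹ * (e * q)) * r) * e := by rw [hrq]; group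
        _ = e⁻¹ * (r⁻¹ * (e * r)) * (r⁻¹ * f * r) * e := by rw [heq]; group
        _ = e⁻¹ * (e * k * F) * e := by rw [her, hF]; group
        _ = e * (k * F) := by
          rw [((Commute.refl e).mul_left hke |>.mul_left hFe).inv_right.symm.eq]
          group
    exact mul_left_cancel (h1.symm.trans h2)
  set m := f⁻¹ * F with hm
  have hm' : m = k⁻¹ * K := by
    rw [hm, eq_inv_mul_iff_mul_eq, ← mul_assoc, ← hfk.symm.inv_right.symm.eq, mul_assoc, ← hFK]
    group
  have hmq : Commute m q := hfq.inv_left.mul_left hFq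
  have hmr : Commute m r := hm' ▸ b1.inv_left.mul_left hKr
  have hme : Commute m e :=
    ((hmr.inv_right.mul_right hmq.inv_right).mul_right hmr).mul_right hmq
  have hmk : Commute m k :=
    ((hme.inv_right.mul_right hmr.inv_right).mul_right hme).mul_right hmr
  have hfr : f * r = r * (f * m) := by simp only [hm, hF]; group
  have hkq : k * q = q * (k * m) := by rw [hm', hK]; group
  have hcom := (rightEngel_commute_zpow_mul hq r 1).eq
  have ht : groupComm q r = e⁻¹ := (groupComm_inv _ _).symm
  have hconj : e * (q * r) * e⁻¹ = q * (f * (r * k)) := by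
    calc e * (q * r) * e⁻¹ = (e * q) * e⁻¹ * (e * r) * e⁻¹ := by group
      _ = q * (e * f) * e⁻¹ * (r * (e * k)) * e⁻¹ := by rw [heq, her]
      _ = q * (f * (r * k)) := by rw [← hfe.eq, ← hke.eq]; group
  rw [ht, inv_inv, zpow_one, hconj] at hcom
  have hm2 : m ^ 2 = 1 := by
    simp only [mul_assoc, hmr.eq, hmk.eq, mul_eq_mul_assoc hrq, mul_eq_mul_assoc hfr,
      mul_eq_mul_assoc her, mul_eq_mul_assoc hkq, mul_eq_mul_assoc hfq.eq,
      mul_eq_mul_assoc b1.eq, mul_eq_mul_assoc hmq.eq, mul_eq_mul_assoc hmr.eq,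
      mul_eq_mul_assoc hfk.symm.eq, mul_eq_mul_assoc hmk.eq, mul_right_inj] at hcom
    simpa [pow_two] using hcom.symm
  have hm1 : m = 1 := by
    refine hG m ?_ hm2
    have : m = groupComm f r := by simp only [hm, hF, groupComm]; group
    rw [this]
    have h2 : e ∈ gam G 2 := groupComm_mem_gam_succ (mem_gam_one r) q
    exact groupComm_mem_gam_succ (groupComm_mem_gam_succ h2 q) r
  rw [hm1, mul_one] at hfr hkq
  exact ⟨hfq, hfr, hkq, b1⟩

end PairCentral

section ConjugatePairs

variable {G : Type*} [Group G]

theorem mul_pow_eq_pow_mul {e r k : G} (h : e * r = r * (e * k)) (hr : Commute k r)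
    (n : ℕ) : e * r ^ n = r ^ n * (e * k ^ n) := by
  induction n with
  | zero => simp
  | succ n ih =>
    calc e * r ^ (n + 1) = e * r ^ n * r := by rw [pow_succ]; group
      _ = r ^ n * e * (k ^ n * r) := by rw [ih]; group
      _ = r ^ n * (e * r) * k ^ n := by rw [(hr.pow_left n).eq]; group
      _ = _ := by rw [h, pow_succ, pow_succ']; group

theorem mul_inv_eq_of_mul_eq {e q f : G} (h : e * q = q * (e * f)) (hq : Commute f q) :
    e * q⁻¹ = q⁻¹ * (e * f⁻¹) := by
  have h2 : e * f * q⁻¹ = q⁻¹ * e := by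
    calc e * f * q⁻¹ = q⁻¹ * (q * (e * f)) * q⁻¹ := by group
      _ = _ := by rw [← h]; group
  calc e * q⁻¹ = e * f * (f⁻¹ * q⁻¹) := by group
    _ = e * f * q⁻¹ * f⁻¹ := by rw [hq.inv_inv.eq]; group
    _ = _ := by rw [h2]; group

theorem rightEngel_pair_eq (hG : TwoFree (gam G 4)) {x : G} (hx : x ∈ rightEngel 3 G) (g : G) :
    groupComm (groupComm (g⁻¹ * x * g) x) x =
      groupComm (groupComm (g⁻¹ * x * g) x) (g⁻¹ * x * g) := by
  have hr := rightEngel_conj hx g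
  obtain ⟨h1, h2, h3, h4⟩ := rightEngel_pair_central hG hx hr
  have hw := commute_groupComm_word hx g
  have he3 := groupComm_conj_self_mem x g
  generalize g⁻¹ * x * g = r at *
  set e := groupComm r x with he
  set f := groupComm e x with hf
  set k := groupComm e r with hk
  have hke : Commute k e := ((h4.inv_right.mul_right h3.inv_right).mul_right h4).mul_right h3
  have hkf : Commute k f := ((hke.inv_right.mul_right h3.inv_right).mul_right hke).mul_right h3
  have her : e * r = r * (e * k) := mul_groupComm_right e r
  have hex : e * x = x * (e * f) := mul_groupComm_right e x
  have hex' := mul_inv_eq_of_mul_eq hex h1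
  have e4 := mul_pow_eq_pow_mul her h4 4
  have e5 := mul_pow_eq_pow_mul hex' h1.inv_inv 4
  have ew : r ^ 3 * x⁻¹ * r * x⁻¹ ^ 3 = r ^ 4 * e * x⁻¹ ^ 4 := by
    rw [he]; simp only [groupComm]; group
  rw [ew] at hw
  have h5 : k ^ 4 = f ^ 4 := by
    have h6 : e * (r ^ 4 * e * x⁻¹ ^ 4) = r ^ 4 * e * x⁻¹ ^ 4 * e * (k ^ 4 * f⁻¹ ^ 4) := by
      calc e * (r ^ 4 * e * x⁻¹ ^ 4) = e * r ^ 4 * (e * x⁻¹ ^ 4) := by group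
        _ = r ^ 4 * e * (k ^ 4 * (x⁻¹ ^ 4 * e)) * f⁻¹ ^ 4 := by rw [e4, e5]; group
        _ = _ := by
          rw [((h3.inv_right.pow_pow 4 4).mul_right (hke.pow_left 4)).eq]; group
    rw [show e * (r ^ 4 * e * x⁻¹ ^ 4) = r ^ 4 * e * x⁻¹ ^ 4 * e from hw.eq] at h6
    have h7 := (left_eq_mul.1 h6)
    rw [inv_pow] at h7
    exact mul_inv_eq_one.1 h7
  have h8 : (k * f⁻¹) ^ 4 = 1 := by
    rw [hkf.inv_right.mul_pow, inv_pow, h5, mul_inv_cancel]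
  have h9 := hG.pow_four (mul_mem (groupComm_mem_gam_succ he3 r)
    (inv_mem (groupComm_mem_gam_succ he3 x))) h8
  exact (mul_inv_eq_one.1 h9).symm

theorem collect_relation {p q r d φ : G} (hqp : q * p = p * (q * d)) (hdq : d * q = q * (d * φ))
    (hdp : d * p = p * (d * φ)) (hdr : d * r = r * (d * φ⁻¹)) (φp : Commute φ p)
    (φq : Commute φ q) (φr : Commute φ r)
    (h : r * (p * q) = q * q * p⁻¹ * q * p * q⁻¹ * p * q⁻¹ * r) :
    r * (p * q) = p * (q * (r * (d ^ 3 * φ⁻¹ ^ 5))) := by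
  have hdq' := mul_inv_eq_of_mul_eq hdq φq
  have φd : Commute φ d := by
    have : d = q⁻¹ * p⁻¹ * (q * p) := by rw [hqp]; group
    rw [this]
    exact (φq.inv_right.mul_right φp.inv_right).mul_right (φq.mul_right φp)
  rw [h]
  simp only [mul_assoc, mul_eq_mul_assoc hqp, mul_eq_mul_assoc hdq, mul_eq_mul_assoc hdq',
    mul_eq_mul_assoc hdp, mul_eq_mul_assoc hdr, hdr, mul_eq_mul_assoc φd.eq,
    mul_eq_mul_assoc φp.inv_left.eq, mul_eq_mul_assoc φd.inv_left.eq,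
    mul_eq_mul_assoc φq.inv_right.eq, φr.eq,
    mul_eq_mul_assoc φr.inv_left.eq, inv_mul_cancel_left,
    mul_inv_cancel_left, pow_succ, pow_zero, one_mul, mul_one, inv_mul_cancel]

end ConjugatePairs

section ConjugateCentral

variable {G : Type*} [Group G]

theorem eq_mul_inv_of_commute_mul {e p q f : G} (hpq : Commute e (p * q)) (hqp : Commute e (q * p))
    (heq : e * q = q * (e * f)) (hfq : Commute f q) (hfe : Commute f e) :
    e * p = p * (e * f⁻¹) ∧ Commute f p := by
  have h1 : e * p = p * (e * f⁻¹) := by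
    have h := hpq.eq
    have h2 : q * e = e * q * f⁻¹ := by rw [heq]; group
    calc e * p = e * (p * q) * q⁻¹ := by group
      _ = p * (q * e) * q⁻¹ := by rw [h]; group
      _ = p * e * (q * f⁻¹ * q⁻¹) := by rw [h2]; group
      _ = p * (e * f⁻¹) := by rw [← hfq.inv_left.eq]; group
  refine ⟨h1, ?_⟩
  have h3 : e * f * p = p * e := by
    calc e * f * p = q⁻¹ * (e * q) * p := by rw [heq]; group
      _ = q⁻¹ * (e * (q * p)) := by group
      _ = _ := by rw [hqp.eq]; group
  have h4 : f * (e * p) = p * e := by rw [← h3, ← hfe.eq]; group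
  rw [h1] at h4
  show f * p = p * f
  calc f * p = f * (p * (e * f⁻¹)) * (f * e⁻¹) := by group
    _ = p * (e * f * e⁻¹) := by rw [h4]; group
    _ = p * f := by rw [← hfe.eq]; group

/-- For a right 3-Engel element `x`, the commutator `[x ^ g, x]` commutes with `x` and `g`, provided
`γ₄` has no element of order two. Moreover its square is `[x ^ g, x ^ (g⁻¹)]`. -/
theorem rightEngel_commute_conj (hG : TwoFree (gam G 4)) {x : G} (hx : x ∈ rightEngel 3 G) (g : G) :
    Commute (groupComm (g⁻¹ * x * g) x) x ∧ Commute (groupComm (g⁻¹ * x * g) x) g ∧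
      (g⁻¹ * x * g) * (g * x * g⁻¹) = (g * x * g⁻¹) * (g⁻¹ * x * g) *
        groupComm (g⁻¹ * x * g) x ^ 2 := by
  have hr := rightEngel_conj hx g
  have hp : g * x * g⁻¹ ∈ rightEngel 3 G := by simpa using rightEngel_conj hx g⁻¹
  obtain ⟨f1, f2, -, -⟩ := rightEngel_pair_central hG hx hr
  obtain ⟨d1, d2, -, -⟩ := rightEngel_pair_central hG hp hx
  have hfk := rightEngel_pair_eq hG hx g
  have hdk := rightEngel_pair_eq hG hp g
  rw [show g⁻¹ * (g * x * g⁻¹) * g = x by group] at hdk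
  have epq := commute_groupComm_zpow hx g 0
  have eqp := commute_groupComm_zpow hx g 1
  have drq := commute_groupComm_zpow hx g⁻¹ 0
  have dqr := commute_groupComm_zpow hx g⁻¹ 1
  simp only [zpow_zero, one_mul, sub_zero, zpow_one, sub_self, mul_one, inv_inv] at epq eqp drq dqr
  have rel1 := rightEngel_conj_relation hx g
  have rel2 := rightEngel_conj_relation hx g⁻¹
  simp only [inv_inv] at rel1 rel2
  have he3 := groupComm_conj_self_mem x g
  have hde : groupComm x (g * x * g⁻¹) = g * groupComm (g⁻¹ * x * g) x * g⁻¹ := by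
    simp only [groupComm]; group
  have hd3 : groupComm x (g * x * g⁻¹) ∈ gam G 3 := hde ▸ (gam_normal 3).conj_mem _ he3 g
  have hinv : groupComm (g * x * g⁻¹) x = (groupComm x (g * x * g⁻¹))⁻¹ := (groupComm_inv _ _).symm
  rw [hinv] at drq dqr
  have dqr := dqr.inv_left
  have drq := drq.inv_left
  rw [inv_inv] at drq dqr
  generalize hpp : g * x * g⁻¹ = p at *
  generalize hrr : g⁻¹ * x * g = r at *
  set e := groupComm r x with he
  set d := groupComm x p with hd
  set f := groupComm e x with hf
  set φ := groupComm d p with hφ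
  have her : e * r = r * (e * f) := by rw [hfk]; exact mul_groupComm_right e r
  have hex : e * x = x * (e * f) := mul_groupComm_right e x
  have hdx : d * x = x * (d * φ) := by rw [hdk]; exact mul_groupComm_right d x
  have hdp : d * p = p * (d * φ) := mul_groupComm_right d p
  have hrx : r * x = x * (r * e) := mul_groupComm_right r x
  have hxp : x * p = p * (x * d) := mul_groupComm_right x p
  have hfe : Commute f e := ((f2.inv_right.mul_right f1.inv_right).mul_right f2).mul_right f1
  have hφd : Commute φ d := ((d2.inv_right.mul_right d1.inv_right).mul_right d2).mul_right d1
  obtain ⟨hep, hfp⟩ := eq_mul_inv_of_commute_mul epq eqp hex f1 hfe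
  obtain ⟨hdr, hφr⟩ := eq_mul_inv_of_commute_mul drq dqr hdx d2 hφd
  have hφe : Commute φ e := ((hφr.inv_right.mul_right d2.inv_right).mul_right hφr).mul_right d2
  have hφf : Commute φ f := ((hφe.inv_right.mul_right d2.inv_right).mul_right hφe).mul_right d2
  have hed : Commute e d := by
    have : d = (p * x)⁻¹ * (x * p) := by rw [hd]; simp only [groupComm]; group
    rw [this]; exact epq.inv_right.mul_right eqp
  have c1 := collect_relation hxp hdx hdp hdr d1 d2 hφr rel1
  have hex' : e⁻¹ * x = x * (e⁻¹ * f⁻¹) := by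
    calc e⁻¹ * x = e⁻¹ * (x * (e * f)) * f⁻¹ * e⁻¹ := by group
      _ = x * (f⁻¹ * e⁻¹) := by rw [← hex]; group
      _ = _ := by rw [hfe.inv_inv.eq]
  have her' : e⁻¹ * r = r * (e⁻¹ * f⁻¹) := by
    calc e⁻¹ * r = e⁻¹ * (r * (e * f)) * f⁻¹ * e⁻¹ := by group
      _ = r * (f⁻¹ * e⁻¹) := by rw [← her]; group
      _ = _ := by rw [hfe.inv_inv.eq]
  have hep' : e⁻¹ * p = p * (e⁻¹ * f⁻¹⁻¹) := by
    calc e⁻¹ * p = e⁻¹ * (p * (e * f⁻¹)) * f * e⁻¹ := by group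
      _ = p * (f * e⁻¹) := by rw [← hep]; group
      _ = _ := by rw [hfe.inv_right.eq, inv_inv]
  have hxr : x * r = r * (x * e⁻¹) := by rw [he]; simp only [groupComm]; group
  have c2 := collect_relation hxr hex' her' hep' f2.inv_left f1.inv_left hfp.inv_left rel2
  have h4 : e ^ 4 * φ ^ 5 = d ^ 4 * f ^ 5 := by
    have h1 : p * (x * r) * e = p * (x * r) * (d ^ 3 * φ⁻¹ ^ 5 * d * (e⁻¹ ^ 3 * f ^ 5)) := by
      calc p * (x * r) * e = p * (r * x) := by rw [hrx]; group
        _ = r * (x * p) * (e⁻¹ ^ 3 * f ^ 5) := by rw [c2, inv_inv]; group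
        _ = r * (p * x) * d * (e⁻¹ ^ 3 * f ^ 5) := by rw [hxp]; group
        _ = _ := by rw [c1]; group
    have h2 := mul_left_cancel h1
    calc e ^ 4 * φ ^ 5 = e * e ^ 3 * φ ^ 5 := by group
      _ = d ^ 3 * φ⁻¹ ^ 5 * d * e⁻¹ ^ 3 * (f ^ 5 * e ^ 3) * φ ^ 5 := by
        nth_rw 1 [h2]; group
      _ = d ^ 3 * φ⁻¹ ^ 5 * (d * φ ^ 5) * f ^ 5 := by
        rw [(hfe.pow_pow 5 3).eq]
        simp only [mul_assoc]
        rw [← (hφf.pow_pow 5 5).eq]; group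
      _ = _ := by rw [← (hφd.pow_left 5).eq]; group
  have h5 : f ^ 4 = φ ^ 4 := by
    have h1 : x⁻¹ * (e ^ 4 * φ ^ 5) * x = x⁻¹ * (d ^ 4 * f ^ 5) * x := by rw [h4]
    have ee : x⁻¹ * e * x = e * f := by rw [mul_assoc, hex]; group
    have dd : x⁻¹ * d * x = d * φ := by rw [mul_assoc, hdx]; group
    have ff : x⁻¹ * f ^ 5 * x = f ^ 5 := by rw [mul_assoc, (f1.pow_left 5).eq]; group
    have pp : x⁻¹ * φ ^ 5 * x = φ ^ 5 := by rw [mul_assoc, (d2.pow_left 5).eq]; group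
    have cp (y : G) : x⁻¹ * y ^ 4 * x = (x⁻¹ * y * x) ^ 4 := by
      simpa using (conj_pow (a := x⁻¹)).symm
    have h2 : (e * f) ^ 4 * φ ^ 5 = (d * φ) ^ 4 * f ^ 5 := by
      rw [← ee, ← dd, ← cp, ← cp]; nth_rw 1 [← pp]; nth_rw 1 [← ff]
      calc _ = x⁻¹ * (e ^ 4 * φ ^ 5) * x := by group
        _ = _ := by rw [h1]; group
    rw [hfe.symm.mul_pow, hφd.symm.mul_pow, (hfe.pow_pow 4 4).symm.eq, (hφd.pow_pow 4 4).symm.eq,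
      mul_assoc, mul_assoc, h4] at h2
    exact mul_right_cancel h2
  have hf4 : f ∈ gam G 4 := groupComm_mem_gam_succ he3 x
  have hφ4 : φ ∈ gam G 4 := groupComm_mem_gam_succ hd3 p
  have h6 : φ = f := by
    refine mul_inv_eq_one.1 (hG.pow_four (mul_mem hφ4 (inv_mem hf4)) ?_)
    rw [hφf.inv_right.mul_pow, inv_pow, h5, mul_inv_cancel]
  have h7 : e ^ 4 = d ^ 4 := by rw [h6] at h4; exact mul_right_cancel h4
  have h8 : e = d := by
    refine inv_mul_eq_one.1 (hG.pow_four ?_ ?_)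
    · rw [hde, show e⁻¹ * (g * e * g⁻¹) = groupComm e g⁻¹ by simp only [groupComm]; group]
      exact groupComm_mem_gam_succ he3 g⁻¹
    · rw [hed.inv_left.mul_pow, inv_pow, h7, inv_mul_cancel]
  have h9 : f = 1 := by
    refine hG f hf4 ?_
    rw [← h8, h6, hep] at hdp
    have := mul_left_cancel (mul_left_cancel hdp)
    rw [pow_two]; nth_rw 1 [← this]; exact inv_mul_cancel f
  rw [h9, mul_one] at hex
  refine ⟨hex, ?_, ?_⟩
  · show e * g = g * e
    nth_rw 1 [h8]; rw [hde]; group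
  · have hxe : Commute e x := hex
    refine mul_right_cancel (b := x) ?_
    calc r * p * x = p * (x * (r * e)) * e ^ 2 := by rw [mul_assoc, c1, h6, h9, ← h8]; group
      _ = p * r * (x * e ^ 2) := by rw [← hrx]; group
      _ = _ := by rw [← (hxe.pow_left 2).eq]; group

end ConjugateCentral

section ConjugacyClass

variable {G : Type*} [Group G]

theorem commutator_closure_le {S T : Set G} {N : Subgroup G} [N.Normal]
    (h : ∀ s ∈ S, ∀ t ∈ T, groupComm s t ∈ N) :
    ⁅Subgroup.closure S, Subgroup.closure T⁆ ≤ N := by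
  have h1 : (⁅Subgroup.closure S, Subgroup.closure T⁆).map (QuotientGroup.mk' N) = ⊥ := by
    rw [Subgroup.map_commutator, Subgroup.commutator_eq_bot_iff_le_centralizer,
      MonoidHom.map_closure, MonoidHom.map_closure, Subgroup.centralizer_closure,
      Subgroup.closure_le]
    rintro _ ⟨s, hs, rfl⟩ _ ⟨t, ht, rfl⟩
    refine (groupComm_eq_one_iff.1 ?_).symm.eq
    rw [← map_groupComm, ← MonoidHom.mem_ker, QuotientGroup.ker_mk']
    exact h s hs t ht
  rwa [Subgroup.map_eq_bot_iff, QuotientGroup.ker_mk'] at h1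

theorem rightEngel_inv_of_twoFree (hG : TwoFree (gam G 4)) {x : G} (hx : x ∈ rightEngel 3 G) :
    x⁻¹ ∈ rightEngel 3 G := by
  rw [mem_rightEngel_three_iff]
  intro g
  obtain ⟨ex, eg, hrp⟩ := rightEngel_commute_conj hG hx g
  have hs := rightEngel_recurrence hx g
  have hrx : g⁻¹ * x * g * x = x * (g⁻¹ * x * g * groupComm (g⁻¹ * x * g) x) :=
    mul_groupComm_right _ _
  have hq : g⁻¹ * x * g * x⁻¹ * (g * x * g⁻¹) = g * x * g⁻¹ * x⁻¹ * (g⁻¹ * x * g) := by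
    generalize groupComm (g⁻¹ * x * g) x = e at *
    have hxp : x * (g * x * g⁻¹) = g * x * g⁻¹ * (x * e) := by
      calc x * (g * x * g⁻¹) = g * (g⁻¹ * x * g * x) * g⁻¹ := by group
        _ = g * x * g⁻¹ * x * (g * e * g⁻¹) := by rw [hrx]; group
        _ = _ := by rw [← eg.eq]; group
    generalize g * x * g⁻¹ = p at *
    generalize g⁻¹ * x * g = r at *
    have ep : p * x⁻¹ = x⁻¹ * p * e := by
      calc p * x⁻¹ = x⁻¹ * (x * p) * x⁻¹ := by group
        _ = x⁻¹ * p * (x * e) * x⁻¹ := by rw [hxp]; group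
        _ = _ := by rw [← ex.eq]; group
    have er : x⁻¹ * r = r * x⁻¹ * e := by
      calc x⁻¹ * r = x⁻¹ * (r * x) * x⁻¹ := by group
        _ = r * (e * x⁻¹) := by rw [hrx]; group
        _ = _ := by rw [ex.inv_right.eq]; group
    calc r * x⁻¹ * p = r * (x⁻¹ * p * e) * e⁻¹ := by group
      _ = r * p * x⁻¹ * e⁻¹ := by rw [← ep]; group
      _ = p * r * (e ^ 2 * x⁻¹) * e⁻¹ := by rw [hrp]; group
      _ = p * (r * x⁻¹ * e) := by rw [(ex.inv_right.pow_left 2).eq]; group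
      _ = _ := by rw [← er]; group
  have hw : g⁻¹ * (g⁻¹ * x * g * x⁻¹ * (g * x * g⁻¹) * x⁻¹) * g =
      g⁻¹ * x * g * x⁻¹ * (g * x * g⁻¹) * x⁻¹ := by
    calc _ = g⁻¹ * (g⁻¹ * x * g) * g * (g⁻¹ * x * g)⁻¹ * x * (g⁻¹ * x * g)⁻¹ := by group
      _ = g⁻¹ * x * g * x⁻¹ * (g⁻¹ * x * g * x⁻¹ * (g * x * g⁻¹)) * (g⁻¹ * x * g)⁻¹ := by
        rw [hs]; group
      _ = g⁻¹ * x * g * x⁻¹ * (g * x * g⁻¹ * x⁻¹ * (g⁻¹ * x * g)) * (g⁻¹ * x * g)⁻¹ := by rw [hq]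
      _ = _ := by group
  have ht : (groupComm x⁻¹ g)⁻¹ * g * groupComm x⁻¹ g =
      g * (g⁻¹ * (g⁻¹ * x * g * x⁻¹ * (g * x * g⁻¹) * x⁻¹) * g) := by
    simp only [groupComm]; group
  rw [ht, hw]
  refine (Commute.refl g).mul_right ?_
  generalize g⁻¹ * x * g * x⁻¹ * (g * x * g⁻¹) * x⁻¹ = w at hw
  show g * w = w * g
  nth_rw 1 [← hw]; group

/-- If `x` is right 3-Engel, then `[x ^ g, x]` commutes with the centralizer of `x`. -/
theorem rightEngel_commute_of_commute (hG : TwoFree (gam G 4)) {x : G} (hx : x ∈ rightEngel 3 G)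
    (g h : G) (hh : Commute h x) : Commute h (groupComm (g⁻¹ * x * g) x) := by
  have h1 := (rightEngel_commute_conj hG hx g).2.1
  have h2 := (rightEngel_commute_conj hG hx (h * g)).2.1
  have h3 : (h * g)⁻¹ * x * (h * g) = g⁻¹ * x * g := by
    calc (h * g)⁻¹ * x * (h * g) = g⁻¹ * h⁻¹ * (x * h) * g := by group
      _ = _ := by rw [← hh.eq]; group
  rw [h3] at h2
  have := (h2.mul_right h1.inv_right).symm
  rwa [mul_inv_cancel_right] at this

/-- In a conjugacy-closed family in which every commutator `[y, z]` commutes with the centralizer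
of `z`, the commutators of pairs satisfy a Hall-Witt type relation. -/
theorem groupComm_hall_witt {K : Set G} (hK : ∀ y ∈ K, ∀ g, g⁻¹ * y * g ∈ K)
    (hC : ∀ y ∈ K, ∀ z ∈ K, ∀ h, Commute h z → Commute h (groupComm y z))
    {x y z : G} (hx : x ∈ K) (hy : y ∈ K) (hz : z ∈ K) :
    Commute (groupComm y z) (groupComm (groupComm y z) x) ∧
    Commute y (groupComm (groupComm y z) x) ∧ Commute z (groupComm (groupComm y z) x) ∧
    groupComm (groupComm x z) y =
      groupComm (groupComm y x) z⁻¹ * groupComm (groupComm y z) x := by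
  have hC' : ∀ y ∈ K, ∀ z ∈ K, ∀ h, Commute h y → Commute h (groupComm y z) := by
    intro y hy z hz h hh
    rw [← groupComm_inv]
    exact (hC z hz y hy h hh).inv_right
  have hconj (y x : G) : x⁻¹ * y * x = y * groupComm y x := by simp only [groupComm]; group
  -- `y` and `[y, w]` commute with `y ^ x`
  have hyy : ∀ y ∈ K, ∀ x ∈ K, Commute y (x⁻¹ * y * x) := by
    intro y hy x hx
    rw [hconj]
    exact (Commute.refl y).mul_right (hC' y hy x hx y (Commute.refl y))
  have hyc : ∀ y ∈ K, ∀ w ∈ K, ∀ x ∈ K, Commute (groupComm y w) (x⁻¹ * y * x) := by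
    intro y hy w hw x hx
    rw [hconj]
    have h1 := (hC' y hy w hw y (Commute.refl y)).symm
    exact h1.mul_right (hC' y hy x hx _ h1)
  have key : ∀ y ∈ K, ∀ z ∈ K, ∀ x ∈ K, ∀ h, Commute h (x⁻¹ * y * x) →
      Commute h (x⁻¹ * groupComm y z * x) := by
    intro y hy z hz x hx h hh
    rw [conj_groupComm]
    exact hC' _ (hK y hy x) _ (hK z hz x) h hh
  have key' : ∀ y ∈ K, ∀ z ∈ K, ∀ x ∈ K, ∀ h, Commute h (x⁻¹ * z * x) →
      Commute h (x⁻¹ * groupComm y z * x) := by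
    intro y hy z hz x hx h hh
    rw [conj_groupComm]
    exact hC _ (hK y hy x) _ (hK z hz x) h hh
  have hT (e x : G) : groupComm e x = e⁻¹ * (x⁻¹ * e * x) := by simp only [groupComm]; group
  have T1 : ∀ y ∈ K, ∀ z ∈ K, ∀ x ∈ K, Commute y (groupComm (groupComm y z) x) := by
    intro y hy z hz x hx
    rw [hT]
    exact (hC' y hy z hz y (Commute.refl y)).inv_right.mul_right
      (key y hy z hz x hx y (hyy y hy x hx))
  have T2 : ∀ y ∈ K, ∀ z ∈ K, ∀ x ∈ K, Commute z (groupComm (groupComm y z) x) := by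
    intro y hy z hz x hx
    rw [hT]
    exact (hC y hy z hz z (Commute.refl z)).inv_right.mul_right
      (key' y hy z hz x hx z (hyy z hz x hx))
  have T3 : ∀ y ∈ K, ∀ z ∈ K, ∀ x ∈ K,
      Commute (groupComm y z) (groupComm (groupComm y z) x) := by
    intro y hy z hz x hx
    rw [hT (groupComm y z) x]
    exact (Commute.refl _).inv_right.mul_right (key y hy z hz x hx _ (hyc y hy z hz x hx))
  refine ⟨T3 y hy z hz x hx, T1 y hy z hz x hx, T2 y hy z hz x hx, ?_⟩
  set E1 := groupComm y x with hE1
  set E2 := groupComm y z with hE2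
  set E3 := groupComm x z with hE3
  have r1 : y * x = x * (y * E1) := mul_groupComm_right y x
  have r2 : y * z = z * (y * E2) := mul_groupComm_right y z
  have r3 : x * z = z * (x * E3) := mul_groupComm_right x z
  have rel : E1 * (x⁻¹ * E2 * x) * E3 = y⁻¹ * E3 * y * E2 * (z⁻¹ * E1 * z) := by
    have h1 : z * x * y * (E1 * (x⁻¹ * E2 * x) * E3) = y * (x * z) := by
      calc _ = z * (x * (y * E1)) * (x⁻¹ * E2 * x) * E3 := by group
        _ = z * (y * E2) * x * E3 := by rw [← r1]; group
        _ = y * (z * (x * E3)) := by rw [← r2]; group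
        _ = _ := by rw [← r3]
    have h2 : z * x * y * (y⁻¹ * E3 * y * E2 * (z⁻¹ * E1 * z)) = y * (x * z) := by
      calc _ = z * (x * E3) * y * E2 * (z⁻¹ * E1 * z) := by group
        _ = x * (z * (y * E2)) * (z⁻¹ * E1 * z) := by rw [← r3]; group
        _ = x * (y * E1) * z := by rw [← r2]; group
        _ = _ := by rw [← r1]; group
    exact mul_left_cancel (h1.trans h2.symm)
  have c12 : Commute E1 E2 := hC' y hy z hz E1 (hC' y hy x hx y (Commute.refl y)).symm
  have c13 : Commute E1 E3 := hC' x hx z hz E1 (hC y hy x hx x (Commute.refl x)).symm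
  have c23 : Commute E2 E3 := hC x hx z hz E2 (hC y hy z hz z (Commute.refl z)).symm
  have hyc' : ∀ y ∈ K, ∀ w ∈ K, ∀ x ∈ K, Commute (groupComm w y) (x⁻¹ * y * x) := by
    intro y hy w hw x hx
    rw [← groupComm_inv]
    exact (hyc y hy w hw x hx).inv_left
  have c3t2 : Commute E3 (groupComm E2 x) := by
    rw [hT E2]
    exact c23.symm.inv_right.mul_right (key' y hy z hz x hx _ (hyc' z hz x hx x hx))
  have c1t3 : Commute E1 (groupComm E3 y) := by
    rw [hT E3]
    exact c13.inv_right.mul_right (key x hx z hz y hy _ (hyc' x hx y hy y hy))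
  have c2t3 : Commute E2 (groupComm E3 y) := by
    rw [hT E3]
    exact c23.inv_right.mul_right (key' x hx z hz y hy _ (hyc' z hz y hy y hy))
  have zt2 : Commute z (groupComm E2 x) := T2 y hy z hz x hx
  have zt3 : Commute z (groupComm E3 y) := T2 x hx z hz y hy
  have yt2 : Commute y (groupComm E2 x) := T1 y hy z hz x hx
  rw [hconj E2, hconj E3, hconj E1] at rel
  have z1 : z * (E1 * groupComm E1 z) * z⁻¹ = E1 := by rw [← hconj]; group
  have z2 : groupComm E1 z⁻¹ = E1⁻¹ * (z * E1 * z⁻¹) := by simp only [groupComm]; group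
  have t23 : Commute (groupComm E3 y) (groupComm E2 x) :=
    ((c3t2.inv_left.mul_left yt2.inv_left).mul_left c3t2).mul_left yt2
  generalize groupComm E1 z = t1 at *
  generalize groupComm E2 x = t2 at *
  generalize groupComm E3 y = t3 at *
  have h1 : t2 = t3 * t1 := by
    refine mul_left_cancel (a := E1 * E2 * E3) ?_
    calc E1 * E2 * E3 * t2 = E1 * (E2 * t2) * E3 := by rw [mul_assoc _ E3, c3t2.eq]; group
      _ = E3 * (t3 * (E2 * E1)) * t1 := by rw [rel]; group
      _ = E3 * (E1 * E2) * t3 * t1 := by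
        rw [← (c2t3.mul_left c1t3).eq, c12.eq]; group
      _ = _ := by rw [← (c13.mul_left c23).eq]; group
  have h2 : t1 = t3⁻¹ * t2 := by rw [h1]; group
  have zt1 : Commute z t1 := by rw [h2]; exact zt3.inv_right.mul_right zt2
  rw [z2, show z * E1 * z⁻¹ = z * (E1 * t1) * z⁻¹ * (z * t1⁻¹ * z⁻¹) by group, z1,
    zt1.inv_right.eq, h2, mul_inv_rev, inv_inv, t23.inv_right.symm.eq]
  group

/-- The conjugates of a right 3-Engel element generate a subgroup of class at most two. -/
theorem rightEngel_normalClosure_class_two (hG : TwoFree (gam G 4)) {x : G}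
    (hx : x ∈ rightEngel 3 G) :
    ⁅⁅Subgroup.normalClosure {x}, Subgroup.normalClosure {x}⁆, Subgroup.normalClosure {x}⁆ = ⊥ := by
  set K : Set G := Set.range fun g => g⁻¹ * x * g with hK
  have conjK : ∀ y ∈ K, ∀ g, g⁻¹ * y * g ∈ K := by
    rintro _ ⟨h, rfl⟩ g
    exact ⟨h * g, by group⟩
  have hC : ∀ y ∈ K, ∀ z ∈ K, ∀ h, Commute h z → Commute h (groupComm y z) := by
    rintro _ ⟨g, rfl⟩ _ ⟨k, rfl⟩ h hh
    have h1 := rightEngel_commute_of_commute hG (rightEngel_conj hx k) (k⁻¹ * g) h hh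
    convert h1 using 2
    group
  have hxK : x ∈ K := ⟨1, by simp⟩
  have swap : ∀ y ∈ K, ∀ z ∈ K, ∀ w ∈ K,
      groupComm (groupComm y z) w = (groupComm (groupComm z y) w)⁻¹ := by
    intro y hy z hz w hw
    have h1 := (groupComm_hall_witt conjK hC hw hy hz).1
    rw [← groupComm_inv y z]
    generalize groupComm y z = e at *
    have h2 : groupComm e⁻¹ w = e * (groupComm e w)⁻¹ * e⁻¹ := by simp only [groupComm]; group
    rw [h2, h1.inv_right.eq]; group
  have rot : ∀ g, ∀ z ∈ K, g⁻¹ * groupComm (groupComm (g⁻¹ * x * g) z) x * g =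
      groupComm (groupComm x z) (g⁻¹ * x * g) := by
    intro g z hz
    have hy : g⁻¹ * x * g ∈ K := ⟨g, rfl⟩
    obtain ⟨h0, h1, h2, h3⟩ := groupComm_hall_witt conjK hC hxK hy hz
    have h4 := (rightEngel_commute_conj hG hx (g * z)).2.1
    have eg := (rightEngel_commute_conj hG hx g).2.1
    have h5 : Commute (groupComm (g⁻¹ * x * g) x) (groupComm (g⁻¹ * x * g) z) := by
      rw [← groupComm_inv z]
      refine (hC _ hz _ hy _ ?_).inv_right
      rw [← groupComm_inv x]
      exact (hC _ hxK _ hy _ (Commute.refl _)).inv_right.symm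
    have h6 : (g * z)⁻¹ * x * (g * z) = g⁻¹ * x * g * groupComm (g⁻¹ * x * g) z := by
      simp only [groupComm]; group
    rw [h3]
    rw [h6] at h4
    generalize g⁻¹ * x * g = y at *
    have h7 : groupComm (y * groupComm y z) x = groupComm y x * groupComm (groupComm y z) x := by
      calc groupComm (y * groupComm y z) x = (groupComm y z)⁻¹ * (groupComm y x * groupComm y z) *
            groupComm (groupComm y z) x := by simp only [groupComm]; group
        _ = _ := by rw [h5.eq]; group
    rw [h7] at h4
    generalize groupComm (groupComm y z) x = τ at *
    generalize groupComm y x = e at *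
    have h8 : groupComm e z⁻¹ = e⁻¹ * z * e * z⁻¹ := by simp only [groupComm]; group
    calc g⁻¹ * τ * g = g⁻¹ * e⁻¹ * (e * τ * (g * z)) * z⁻¹ := by group
      _ = g⁻¹ * (e⁻¹ * g) * z * e * (τ * z⁻¹) := by rw [h4.eq]; group
      _ = _ := by rw [eg.inv_left.eq, ← h2.inv_left.eq, h8]; group
  have shift : ∀ g h, groupComm (groupComm (g⁻¹ * x * g) (h⁻¹ * x * h)) x =
      groupComm (groupComm (g⁻¹⁻¹ * x * g⁻¹) ((h * g⁻¹)⁻¹ * x * (h * g⁻¹))) x := by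
    intro g h
    have h1 := rot g (h⁻¹ * x * h) ⟨h, rfl⟩
    calc _ = g * (g⁻¹ * groupComm (groupComm (g⁻¹ * x * g) (h⁻¹ * x * h)) x * g) * g⁻¹ := by group
      _ = _ := by rw [h1]; simp only [groupComm]; group
  have swap' : ∀ g h, groupComm (groupComm (g⁻¹ * x * g) (h⁻¹ * x * h)) x =
      (groupComm (groupComm (h⁻¹ * x * h) (g⁻¹ * x * g)) x)⁻¹ :=
    fun g h => swap _ ⟨g, rfl⟩ _ ⟨h, rfl⟩ _ hxK
  have main : ∀ g h, groupComm (groupComm (g⁻¹ * x * g) (h⁻¹ * x * h)) x = 1 := by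
    intro g h
    refine hG _ ?_ ?_
    · refine groupComm_mem_gam_succ ?_ x
      have := groupComm_conj_self_mem (h⁻¹ * x * h) (h⁻¹ * g)
      convert this using 2
      group
    · have h1 : groupComm (groupComm (g⁻¹ * x * g) (h⁻¹ * x * h)) x =
          (groupComm (groupComm (g⁻¹ * x * g) (h⁻¹ * x * h)) x)⁻¹ := by
        conv_lhs => rw [shift, swap', shift, swap', inv_inv]
        rw [← swap' h g, shift h g]
        congr 3 <;> group
      rw [pow_two]
      nth_rw 1 [h1]
      exact inv_mul_cancel _
  have hcl : Subgroup.normalClosure {x} = Subgroup.closure K := by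
    rw [Subgroup.normalClosure]
    congr 1
    ext y
    simp only [Group.mem_conjugatesOfSet_iff, Set.mem_singleton_iff, exists_eq_left, hK,
      Set.mem_range, isConj_iff]
    exact ⟨fun ⟨c, hc⟩ => ⟨c⁻¹, by simpa using hc⟩, fun ⟨c, hc⟩ => ⟨c⁻¹, by simpa using hc⟩⟩
  have comm3 : ∀ y ∈ K, ∀ z ∈ K, groupComm y z ∈
      Subgroup.centralizer (Subgroup.normalClosure {x} : Set G) := by
    rintro _ ⟨g, rfl⟩ _ ⟨h, rfl⟩
    rw [hcl, Subgroup.centralizer_closure, Subgroup.mem_centralizer_iff]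
    rintro _ ⟨k, rfl⟩
    have h1 := groupComm_eq_one_iff.1 (main (g * k⁻¹) (h * k⁻¹))
    have h2 : groupComm (g⁻¹ * x * g) (h⁻¹ * x * h) = k⁻¹ *
      groupComm ((g * k⁻¹)⁻¹ * x * (g * k⁻¹)) ((h * k⁻¹)⁻¹ * x * (h * k⁻¹)) * k := by
      simp only [groupComm]; group
    rw [h2]
    generalize groupComm ((g * k⁻¹)⁻¹ * x * (g * k⁻¹)) ((h * k⁻¹)⁻¹ * x * (h * k⁻¹)) = e at *
    calc k⁻¹ * x * k * (k⁻¹ * e * k) = k⁻¹ * (x * e) * k := by group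
      _ = _ := by rw [← h1.eq]; group
  rw [Subgroup.commutator_eq_bot_iff_le_centralizer]
  conv_lhs => rw [hcl]
  exact commutator_closure_le comm3

end ConjugacyClass

section Descent

variable {G : Type*} [Group G]

theorem commutator_sup_le {X Y Z N : Subgroup G} [N.Normal] (h1 : ⁅X, Z⁆ ≤ N) (h2 : ⁅Y, Z⁆ ≤ N) :
    ⁅X ⊔ Y, Z⁆ ≤ N := by
  have hZ : Z = Subgroup.closure (Z : Set G) := (Subgroup.closure_eq Z).symm
  rw [Subgroup.sup_eq_closure, hZ]
  refine commutator_closure_le ?_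
  rintro s (hs | hs) t ht
  · exact h1 (groupComm_mem_commutator hs ht)
  · exact h2 (groupComm_mem_commutator hs ht)

/-- The iterated commutator subgroup `[X, G, ..., G]`. -/
def iterComm (X : Subgroup G) : ℕ → Subgroup G
  | 0 => X
  | n + 1 => ⁅iterComm X n, ⊤⁆

instance iterComm_normal (X : Subgroup G) [X.Normal] (n : ℕ) : (iterComm X n).Normal := by
  induction n with
  | zero => assumption
  | succ n ih => rw [iterComm]; infer_instance

theorem iterComm_mono {X Y : Subgroup G} (h : X ≤ Y) (n : ℕ) : iterComm X n ≤ iterComm Y n := by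
  induction n with
  | zero => exact h
  | succ n ih => exact Subgroup.commutator_mono ih le_rfl

theorem iterComm_iterComm (X : Subgroup G) (m n : ℕ) :
    iterComm (iterComm X m) n = iterComm X (m + n) := by
  induction n with
  | zero => rfl
  | succ n ih => rw [iterComm, ih]; rfl

theorem iterComm_antitone (X : Subgroup G) [X.Normal] : Antitone (iterComm X) :=
  antitone_nat_of_succ_le fun _ => Subgroup.commutator_le_left _ _

theorem iterComm_sup_le (X Y : Subgroup G) [X.Normal] [Y.Normal] (n : ℕ) :
    iterComm (X ⊔ Y) n ≤ iterComm X n ⊔ iterComm Y n := by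
  induction n with
  | zero => exact le_rfl
  | succ n ih =>
    refine (Subgroup.commutator_mono ih le_rfl).trans ?_
    exact commutator_sup_le (N := iterComm X (n + 1) ⊔ iterComm Y (n + 1)) le_sup_left le_sup_right

/-- Some iterated commutator subgroup `[X, G, ..., G]` lies in `Y`. -/
def Descends (X Y : Subgroup G) : Prop := ∃ n, iterComm X n ≤ Y

theorem Descends.of_le {X Y : Subgroup G} (h : X ≤ Y) : Descends X Y := ⟨0, h⟩

theorem Descends.trans {X Y Z : Subgroup G} (h1 : Descends X Y) (h2 : Descends Y Z) :
    Descends X Z := by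
  obtain ⟨m, hm⟩ := h1
  obtain ⟨n, hn⟩ := h2
  exact ⟨m + n, iterComm_iterComm X m n ▸ (iterComm_mono hm n).trans hn⟩

theorem Descends.mono {X Y Z : Subgroup G} (h1 : Descends X Y) (h2 : Y ≤ Z) : Descends X Z :=
  h1.trans (.of_le h2)

theorem Descends.of_commutator {X Y : Subgroup G} (h : Descends ⁅X, ⊤⁆ Y) : Descends X Y :=
  Descends.trans ⟨1, le_rfl⟩ h

theorem Descends.sup {X Y Z : Subgroup G} [X.Normal] [Y.Normal] (h1 : Descends X Z)
    (h2 : Descends Y Z) : Descends (X ⊔ Y) Z := by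
  obtain ⟨m, hm⟩ := h1
  obtain ⟨n, hn⟩ := h2
  refine ⟨m + n, (iterComm_sup_le X Y _).trans (sup_le ?_ ?_)⟩
  · exact (iterComm_antitone X (Nat.le_add_right m n)).trans hm
  · exact (iterComm_antitone Y (Nat.le_add_left n m)).trans hn

theorem Descends.commutator {X Y X' Y' : Subgroup G} [X.Normal] [Y.Normal]
    (h1 : Descends X X') (h2 : Descends Y Y') : Descends ⁅X, Y⁆ (⁅X', Y⁆ ⊔ ⁅X, Y'⁆) := by
  obtain ⟨m, hm⟩ := h1
  obtain ⟨n, hn⟩ := h2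
  have key : ∀ k i j, m + n ≤ i + j + k →
      Descends ⁅iterComm X i, iterComm Y j⁆ (⁅X', Y⁆ ⊔ ⁅X, Y'⁆) := by
    intro k
    induction k with
    | zero =>
      intro i j hij
      rcases le_or_gt m i with h | h
      · exact .of_le (le_sup_of_le_left (Subgroup.commutator_mono
          ((iterComm_antitone X h).trans hm) (iterComm_antitone Y (Nat.zero_le j))))
      · exact .of_le (le_sup_of_le_right (Subgroup.commutator_mono
          (iterComm_antitone X (Nat.zero_le i)) ((iterComm_antitone Y (by omega)).trans hn)))
    | succ k ih =>
      intro i j hij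
      refine Descends.of_commutator (Descends.trans (.of_le ?_)
        ((ih (i + 1) j (by omega)).sup (ih i (j + 1) (by omega))))
      refine Subgroup.commutator_commutator_le_of_rotate ?_ ?_
      · rw [Subgroup.commutator_comm]
        exact le_sup_right
      · rw [Subgroup.commutator_comm ⊤]
        exact le_sup_left
  exact key (m + n) 0 0 (by omega)

theorem commutator_normalClosure_le {S : Set G} (hS : Subgroup.closure S = ⊤) {M : Subgroup G}
    [M.Normal] {y : G} (h : ∀ s ∈ S, groupComm y s ∈ M) :
    ⁅Subgroup.normalClosure {y}, ⊤⁆ ≤ M := by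
  have h1 : ∀ t, groupComm y t ∈ M := by
    intro t
    have := commutator_closure_le (S := {y}) (T := S) (N := M) (by rintro _ rfl t ht; exact h t ht)
    rw [hS] at this
    exact this (groupComm_mem_commutator (Subgroup.subset_closure rfl) trivial)
  have h2 : (⊤ : Subgroup G) = Subgroup.closure Set.univ := Subgroup.closure_univ.symm
  rw [Subgroup.normalClosure, h2]
  refine commutator_closure_le ?_
  intro s hs t _
  simp only [Group.mem_conjugatesOfSet_iff, Set.mem_singleton_iff, exists_eq_left, isConj_iff] at hs
  obtain ⟨c, rfl⟩ := hs
  have h3 : groupComm (c * y * c⁻¹) t = c * groupComm y (c⁻¹ * t * c) * c⁻¹ := by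
    simp only [groupComm]; group
  rw [h3]
  exact ‹M.Normal›.conj_mem _ (h1 _) c

theorem descends_normalClosure {a b c : G} (hG : Subgroup.closure {a, b, c} = ⊤)
    (ha : groupComm (groupComm (groupComm a c) c) c = 1) {A B : Subgroup G} [A.Normal] [B.Normal]
    (hA : A = Subgroup.normalClosure {a}) (hb : b ∈ B) : Descends A (⁅A, A⁆ ⊔ ⁅A, B⁆) := by
  set N := ⁅A, A⁆ ⊔ ⁅A, B⁆ with hN
  have haA : a ∈ A := hA ▸ Subgroup.subset_normalClosure rfl
  have step : ∀ y ∈ A, Descends (Subgroup.normalClosure {groupComm y c}) N →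
      Descends (Subgroup.normalClosure {y}) N := by
    intro y hy hd
    refine Descends.of_commutator (Descends.trans (.of_le ?_) (hd.sup (.of_le (le_refl N))))
    refine commutator_normalClosure_le hG ?_
    rintro s (rfl | rfl | rfl)
    · exact Subgroup.mem_sup_right (Subgroup.mem_sup_left (groupComm_mem_commutator hy haA))
    · exact Subgroup.mem_sup_right (Subgroup.mem_sup_right (groupComm_mem_commutator hy hb))
    · exact Subgroup.mem_sup_left (Subgroup.subset_normalClosure rfl)
  have hmem : ∀ y ∈ A, groupComm y c ∈ A := fun y hy =>
    Subgroup.commutator_le_left A ⊤ (groupComm_mem_commutator hy trivial)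
  rw [hA]
  refine step a haA (step _ (hmem _ haA) (step _ (hmem _ (hmem _ haA)) ?_))
  rw [ha]
  exact .of_le (Subgroup.normalClosure_le_normal (Set.singleton_subset_iff.2 (one_mem N)))

theorem descends_mixed {A B : Subgroup G} [A.Normal] [B.Normal]
    (hA : Descends A (⁅A, A⁆ ⊔ ⁅A, B⁆)) (hB : Descends B (⁅B, B⁆ ⊔ ⁅B, A⁆))
    (hA2 : ⁅⁅A, A⁆, A⁆ = ⊥) (hB2 : ⁅⁅B, B⁆, B⁆ = ⊥) :
    Descends ⁅A, B⁆ (⁅⁅A, B⁆, A⁆ ⊔ ⁅⁅A, B⁆, B⁆) ∧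
    Descends ⁅⁅A, B⁆, A⁆ (⁅⁅⁅A, B⁆, A⁆, B⁆ ⊔ ⁅⁅⁅A, B⁆, B⁆, A⁆) ∧
    Descends ⁅⁅⁅A, B⁆, A⁆, B⁆ ⊥ := by
  have hJ : ⁅B, A⁆ = ⁅A, B⁆ := Subgroup.commutator_comm _ _
  rw [hJ] at hB
  have hJA : ⁅A, B⁆ ≤ A := Subgroup.commutator_le_left _ _
  have hJB : ⁅A, B⁆ ≤ B := Subgroup.commutator_le_right _ _
  have hrot1 : ⁅⁅A, A⁆, B⁆ ≤ ⁅⁅A, B⁆, A⁆ :=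
    Subgroup.commutator_commutator_le_of_rotate le_rfl (by rw [hJ])
  have hrot2 : ⁅⁅B, B⁆, A⁆ ≤ ⁅⁅A, B⁆, B⁆ :=
    Subgroup.commutator_commutator_le_of_rotate (by rw [hJ]) le_rfl
  have hrot3 : ⁅⁅A, B⁆, ⁅A, B⁆⁆ ≤ ⁅⁅⁅A, B⁆, A⁆, B⁆ ⊔ ⁅⁅⁅A, B⁆, B⁆, A⁆ := by
    refine Subgroup.commutator_commutator_le_of_rotate ?_ le_sup_left
    rw [Subgroup.commutator_comm B]
    exact le_sup_right
  have st1 : Descends ⁅A, B⁆ (⁅⁅A, B⁆, A⁆ ⊔ ⁅⁅A, B⁆, B⁆) := by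
    refine (hA.commutator hB).mono (sup_le ?_ ?_)
    · exact commutator_sup_le (hrot1.trans le_sup_left) le_sup_right
    · rw [Subgroup.commutator_comm A]
      exact commutator_sup_le (hrot2.trans le_sup_right) le_sup_left
  have st2 : Descends ⁅⁅A, B⁆, A⁆ (⁅⁅⁅A, B⁆, A⁆, B⁆ ⊔ ⁅⁅⁅A, B⁆, B⁆, A⁆) := by
    refine (st1.commutator hA).mono (sup_le ?_ ?_)
    · refine commutator_sup_le (le_trans ?_ (hA2.trans_le bot_le)) le_sup_right
      exact Subgroup.commutator_mono (Subgroup.commutator_mono hJA le_rfl) le_rfl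
    · rw [Subgroup.commutator_comm _ (⁅A, A⁆ ⊔ ⁅A, B⁆)]
      refine commutator_sup_le (le_trans ?_ (hA2.trans_le bot_le)) hrot3
      exact Subgroup.commutator_mono le_rfl hJA
  refine ⟨st1, st2, (st2.commutator hB).mono (sup_le ?_ ?_)⟩
  · refine commutator_sup_le (le_trans ?_ hB2.le) (le_trans ?_ hB2.le)
    · exact Subgroup.commutator_mono (Subgroup.commutator_mono
        ((Subgroup.commutator_le_left _ _).trans hJB) le_rfl) le_rfl
    · exact Subgroup.commutator_mono ((Subgroup.commutator_le_left _ _).trans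
        (Subgroup.commutator_mono hJB le_rfl)) le_rfl
  · rw [Subgroup.commutator_comm _ (⁅B, B⁆ ⊔ ⁅A, B⁆)]
    refine commutator_sup_le (le_trans ?_ hB2.le) (le_trans ?_ hA2.le)
    · exact Subgroup.commutator_mono le_rfl ((Subgroup.commutator_le_left _ _).trans hJB)
    · rw [Subgroup.commutator_comm]
      exact Subgroup.commutator_mono (Subgroup.commutator_mono hJA le_rfl) hJA

theorem descends_bot {a b c : G} (hG : Subgroup.closure {a, b, c} = ⊤)
    {A B : Subgroup G} [A.Normal] [B.Normal] (haA : a ∈ A) (hbB : b ∈ B)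
    (hA : Descends A (⁅A, A⁆ ⊔ ⁅A, B⁆)) (hB : Descends B (⁅B, B⁆ ⊔ ⁅B, A⁆))
    (hA2 : ⁅⁅A, A⁆, A⁆ = ⊥) (hB2 : ⁅⁅B, B⁆, B⁆ = ⊥) : Descends (⊤ : Subgroup G) ⊥ := by
  obtain ⟨h1, h2, h3⟩ := descends_mixed hA hB hA2 hB2
  obtain ⟨-, h5, h6⟩ := descends_mixed hB hA hB2 hA2
  have hJ : ⁅B, A⁆ = ⁅A, B⁆ := Subgroup.commutator_comm _ _
  rw [hJ] at h5 h6 hB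
  have kA := h2.trans (h3.sup h6)
  have kB := h5.trans (h6.sup h3)
  have kJ := h1.trans (kA.sup kB)
  have sq : ∀ (X : Subgroup G) [X.Normal], Descends X (⁅X, X⁆ ⊔ ⁅A, B⁆) → ⁅⁅X, X⁆, X⁆ = ⊥ →
      Descends ⁅⁅A, B⁆, X⁆ ⊥ → Descends X ⊥ := by
    intro X _ hX hX2 hJX
    refine hX.trans (Descends.sup ((hX.commutator hX).trans (Descends.trans (.of_le ?_) hJX)) kJ)
    rw [Subgroup.commutator_comm X (⁅X, X⁆ ⊔ ⁅A, B⁆), sup_idem]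
    exact commutator_sup_le (hX2.trans_le bot_le) le_rfl
  have dA := sq A hA hA2 kA
  have dB := sq B hB hB2 kB
  refine Descends.of_commutator (Descends.trans (.of_le ?_) (dA.sup dB))
  nth_rw 1 [← hG]
  nth_rw 1 [← hG]
  refine commutator_closure_le ?_
  have hX : ∀ {x : G} (X : Subgroup G) [X.Normal], x ∈ X → ∀ y, groupComm x y ∈ X ∧
      groupComm y x ∈ X := fun X _ hx y =>
    ⟨Subgroup.commutator_le_left X ⊤ (groupComm_mem_commutator hx trivial),
      Subgroup.commutator_le_right ⊤ X (groupComm_mem_commutator trivial hx)⟩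
  rintro s (rfl | rfl | rfl) t ht
  · exact Subgroup.mem_sup_left (hX A haA t).1
  · exact Subgroup.mem_sup_right (hX B hbB t).1
  · rcases ht with rfl | rfl | rfl
    · exact Subgroup.mem_sup_left (hX A haA s).2
    · exact Subgroup.mem_sup_right (hX B hbB s).2
    · rw [groupComm_eq_one_iff.2 (Commute.refl _)]
      exact one_mem _

theorem iterComm_top (n : ℕ) : iterComm (⊤ : Subgroup G) n = gam G (n + 1) := by
  induction n with
  | zero => rfl
  | succ n ih => rw [iterComm, ih, gam_succ_succ]

theorem exists_gam_eq_bot (hG : TwoFree (gam G 4)) {a b c : G} (ha : a ∈ rightEngel 3 G)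
    (hb : b ∈ rightEngel 3 G) (habc : Subgroup.closure {a, b, c} = ⊤) : ∃ n, gam G n = ⊥ := by
  have hbac : Subgroup.closure {b, a, c} = ⊤ := by rw [Set.insert_comm, habc]
  obtain ⟨n, hn⟩ := descends_bot habc (Subgroup.subset_normalClosure (Set.mem_singleton a))
    (Subgroup.subset_normalClosure (Set.mem_singleton b))
    (descends_normalClosure habc (ha c) rfl (Subgroup.subset_normalClosure (Set.mem_singleton b)))
    (descends_normalClosure hbac (hb c) rfl (Subgroup.subset_normalClosure (Set.mem_singleton a)))
    (rightEngel_normalClosure_class_two hG ha) (rightEngel_normalClosure_class_two hG hb)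
  exact ⟨n + 1, by rw [← iterComm_top, ← le_bot_iff]; exact hn⟩

end Descent

section LieRing

variable {L : Type*} [LieRing L]

theorem lie_lie_swap (x y z : L) : ⁅⁅x, y⁆, z⁆ = ⁅⁅x, z⁆, y⁆ + ⁅x, ⁅y, z⁆⁆ := by
  rw [lie_lie, ← lie_skew ⁅x, z⁆ y]; abel

/-- The linearized consequences, in a Lie ring, of being the image of a right 3-Engel element whose
normal closure has class at most two. -/
structure LieEngel (S : Set L) (a : L) : Prop where
  class_two : ∃ A : AddSubgroup L, a ∈ A ∧ (∀ y ∈ A, ∀ m : L, ⁅y, m⁆ ∈ A) ∧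
    ∀ y ∈ A, ∀ z ∈ A, ∀ w ∈ A, ⁅⁅y, z⁆, w⁆ = 0
  anti : ∀ u v : L, ⁅⁅⁅a, u⁆, a⁆, v⁆ + ⁅⁅⁅a, v⁆, a⁆, u⁆ = 0
  cube : ∀ u ∈ S, ⁅⁅⁅a, u⁆, u⁆, u⁆ = 0
  linear : ∀ u ∈ S, ∀ v : L, ⁅⁅⁅a, u⁆, u⁆, v⁆ + ⁅⁅⁅a, u⁆, v⁆, u⁆ + ⁅⁅⁅a, v⁆, u⁆, u⁆ = 0

theorem LieEngel.pair {S : Set L} {a b c : L} (h2 : ∀ x : L, (2 : ℤ) • x = 0 → x = 0)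
    (ha : LieEngel S a) (hb : LieEngel S b) (hc : c ∈ S) :
    ⁅⁅⁅a, c⁆, c⁆, b⁆ = ⁅a, ⁅⁅b, c⁆, c⁆⁆ ∧
    (4 : ℤ) • ⁅⁅⁅a, c⁆, c⁆, b⁆ + (3 : ℤ) • ⁅⁅a, c⁆, ⁅b, c⁆⁆ = 0 ∧
    ⁅⁅⁅a, c⁆, c⁆, ⁅b, c⁆⁆ = 0 ∧ ⁅⁅a, c⁆, ⁅⁅b, c⁆, c⁆⁆ = 0 := by
  have a3 := ha.cube c hc
  have b3 := hb.cube c hc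
  have e1 := ha.linear c hc b
  have e2 := hb.linear c hc a
  have e3 := hb.linear c hc ⁅a, c⁆
  have hD : ∀ x y : L, ⁅⁅x, y⁆, c⁆ = ⁅⁅x, c⁆, y⁆ + ⁅x, ⁅y, c⁆⁆ := fun x y => lie_lie_swap x y c
  rw [hD ⁅a, c⁆ b, hD a b, add_lie, hD ⁅a, c⁆ b, hD a ⁅b, c⁆] at e1
  rw [hD ⁅b, c⁆ a, hD b a, add_lie, hD ⁅b, c⁆ a, hD b ⁅a, c⁆] at e2
  rw [hD ⁅b, c⁆ ⁅a, c⁆, hD b ⁅a, c⁆, add_lie, hD ⁅b, c⁆ ⁅a, c⁆, hD b ⁅⁅a, c⁆, c⁆, a3] at e3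
  rw [← lie_skew _ a, ← lie_skew _ ⁅a, c⁆, ← lie_skew _ ⁅⁅a, c⁆, c⁆] at e2
  rw [← lie_skew _ ⁅a, c⁆, ← lie_skew _ ⁅⁅a, c⁆, c⁆, lie_zero] at e3
  have hX : ⁅⁅⁅a, c⁆, c⁆, b⁆ = ⁅a, ⁅⁅b, c⁆, c⁆⁆ := by
    refine sub_eq_zero.1 (h2 _ ?_)
    linear_combination (norm := module) e1 + e2
  have hY : (4 : ℤ) • ⁅⁅⁅a, c⁆, c⁆, b⁆ + (3 : ℤ) • ⁅⁅a, c⁆, ⁅b, c⁆⁆ = 0 := by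
    linear_combination (norm := module) e1 + hX
  have d1 := congrArg (fun x => ⁅x, c⁆) hX
  have d2 := congrArg (fun x => ⁅x, c⁆) hY
  simp only [add_lie, zsmul_lie, zero_lie, hD _ b, hD _ ⁅b, c⁆, hD _ ⁅⁅b, c⁆, c⁆, a3, b3, lie_zero,
    zero_add, add_zero] at d1 d2
  have h0 : ⁅⁅⁅a, c⁆, c⁆, ⁅b, c⁆⁆ = 0 := by
    have h3 : (3 : ℤ) • ⁅⁅⁅a, c⁆, c⁆, ⁅b, c⁆⁆ = 0 := by
      refine h2 _ ?_
      linear_combination (norm := module) (3 : ℤ) • d1 - e3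
    have h5 : (5 : ℤ) • ⁅⁅⁅a, c⁆, c⁆, ⁅b, c⁆⁆ = 0 := by
      refine h2 _ ?_
      linear_combination (norm := module) d2 + (3 : ℤ) • d1
    linear_combination (norm := module) (2 : ℤ) • h3 - h5
  exact ⟨hX, hY, h0, d1 ▸ h0⟩

theorem LieEngel.adjoint {S : Set L} {a c : L} (h2 : ∀ x : L, (2 : ℤ) • x = 0 → x = 0)
    (ha : LieEngel S a) (hc : c ∈ S) :
    ⁅⁅a, ⁅a, c⁆⁆, c⁆ = 0 ∧ ⁅a, ⁅⁅a, c⁆, c⁆⁆ = 0 ∧ ⁅⁅a, c⁆, ⁅⁅a, c⁆, c⁆⁆ = 0 := by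
  have h1 : ⁅⁅a, ⁅a, c⁆⁆, c⁆ = 0 := by
    rw [← lie_skew a, neg_lie, neg_eq_zero]
    refine h2 _ ?_
    linear_combination (norm := module) ha.anti c c
  have h3 : ⁅a, ⁅⁅a, c⁆, c⁆⁆ = 0 := by
    rwa [lie_lie_swap, lie_self, zero_add] at h1
  refine ⟨h1, h3, ?_⟩
  have h4 := congrArg (fun x => ⁅x, c⁆) h3
  rwa [lie_lie_swap, ha.cube c hc, lie_zero, add_zero, zero_lie] at h4

theorem lie_lie_lie_derivation (x y z c : L) :
    ⁅⁅⁅x, y⁆, z⁆, c⁆ = ⁅⁅⁅x, c⁆, y⁆, z⁆ + ⁅⁅x, ⁅y, c⁆⁆, z⁆ + ⁅⁅x, y⁆, ⁅z, c⁆⁆ := by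
  rw [lie_lie_swap ⁅x, y⁆ z c, lie_lie_swap x y c, add_lie]

theorem lie_lie_sub_lie_lie (x y z : L) : ⁅⁅x, y⁆, z⁆ - ⁅⁅z, y⁆, x⁆ = ⁅⁅x, z⁆, y⁆ := by
  rw [lie_lie_swap x y z, ← lie_skew x ⁅y, z⁆, ← lie_skew y z, neg_lie]; abel

/-- Relations of degree two in `a` and one in `b`. -/
structure LieTriple (c a a' a'' b b' b'' α η τ σ : L) : Prop where
  lie_c_T000 : ⁅⁅⁅a, b⁆, a⁆, c⁆ = η
  lie_b_T000 : ⁅⁅⁅a, b⁆, a⁆, b⁆ = 0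
  lie_a_T000 : ⁅⁅⁅a, b⁆, a⁆, a⁆ = 0
  lie_b'_T000 : ⁅⁅⁅a, b⁆, a⁆, b'⁆ = (2 : ℤ) • ⁅α, b⁆
  lie_b''_T000 : ⁅⁅⁅a, b⁆, a⁆, b''⁆ = (2 : ℤ) • ⁅τ, b⁆
  T010 : ⁅⁅a, b'⁆, a⁆ = (-2 : ℤ) • α
  T001 : ⁅⁅a, b⁆, a'⁆ = α + η
  T020 : ⁅⁅a, b''⁆, a⁆ = (-2 : ℤ) • τ
  T200 : ⁅⁅a'', b⁆, a⁆ = (-2 : ℤ) • τ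
  T002 : ⁅⁅a, b⁆, a''⁆ = (-2 : ℤ) • τ
  T011 : ⁅⁅a, b'⁆, a'⁆ = (3 : ℤ) • τ - (2 : ℤ) • σ
  lie_c_α : ⁅α, c⁆ = σ - τ
  lie_c_η : ⁅η, c⁆ = (2 : ℤ) • τ - (2 : ℤ) • σ
  lie_c_τ : ⁅τ, c⁆ = 0
  lie_c_σ : ⁅σ, c⁆ = 0
  lie_a_ε : ⁅⁅a, a'⁆, a⁆ = 0
  lie_a_α : ⁅α, a⁆ = 0
  lie_a_η : ⁅η, a⁆ = 0
  lie_a_τ : ⁅τ, a⁆ = 0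
  lie_a_σ : ⁅σ, a⁆ = 0
  lie_a_κ : ⁅⁅α, b⁆, a⁆ = 0

theorem LieEngel.triple {S : Set L} {a a' a'' b b' b'' c : L}
    (h2 : ∀ x : L, (2 : ℤ) • x = 0 → x = 0) (ha : LieEngel S a) (hb : LieEngel S b) (hc : c ∈ S)
    (ha' : ⁅a, c⁆ = a') (ha'' : ⁅a', c⁆ = a'') (hb' : ⁅b, c⁆ = b') (hb'' : ⁅b', c⁆ = b'') :
    LieTriple c a a' a'' b b' b'' ⁅⁅a', b⁆, a⁆ ⁅⁅a, a'⁆, b⁆ ⁅⁅a', b'⁆, a⁆ ⁅⁅a', b⁆, a'⁆ := by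
  obtain ⟨hX, hY, h21, h12⟩ := ha.pair h2 hb hc
  obtain ⟨ε', h02, h12'⟩ := ha.adjoint h2 hc
  have a3 := ha.cube c hc
  have b3 := hb.cube c hc
  have anti_c := fun v => ha.anti c v
  have ε3 := hb.linear c hc ⁅a, ⁅a, c⁆⁆
  simp only [ha', ha'', hb', hb''] at hX hY h21 h12 ε' h02 h12' a3 b3 anti_c ε3
  have D := fun x y z : L => lie_lie_lie_derivation x y z c
  have hsym := fun x y z : L => lie_lie_sub_lie_lie x y z
  have anti_c' : ∀ v : L, ⁅⁅⁅a, v⁆, a⁆, c⁆ = ⁅⁅a, a'⁆, v⁆ := by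
    intro v
    have := anti_c v
    rw [← lie_skew a' a, neg_lie] at this
    linear_combination (norm := module) this
  have D000 := D a b a
  have D010 := D a b' a
  have D020 := D a b'' a
  have D100 := D a' b a
  have D110 := D a' b' a
  have D101 := D a' b a'
  simp only [anti_c', ha', ha'', hb', hb'', b3, lie_zero, zero_lie, h12, h21, add_zero,
    zero_add] at D000 D010 D020 D100 D110 D101
  have s001 := hsym a b a'
  have s011 := hsym a b' a'
  have s021 := hsym a b'' a'
  have s002 := hsym a b a''
  have s102 := hsym a' b a''
  have s012 := hsym a b' a''
  simp only [h02, h12, h12', h21, zero_lie, sub_zero] at s001 s011 s021 s002 s102 s012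
  have X0 := congrArg (fun x => ⁅x, a⁆) hX
  have X1 := congrArg (fun x => ⁅x, a'⁆) hX
  have Y0 := congrArg (fun x => ⁅x, a⁆) hY
  have Y1 := congrArg (fun x => ⁅x, a'⁆) hY
  simp only [add_lie, zsmul_lie, zero_lie] at X0 X1 Y0 Y1
  have T010 : ⁅⁅a, b'⁆, a⁆ = (-2 : ℤ) • ⁅⁅a', b⁆, a⁆ := by
    linear_combination (norm := module) -D000 - s001
  have T020 : ⁅⁅a, b''⁆, a⁆ = (-2 : ℤ) • ⁅⁅a', b'⁆, a⁆ := by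
    linear_combination (norm := module) -D010 - s011
  have ε3' : (3 : ℤ) • ⁅⁅a, a'⁆, b''⁆ = 0 := by
    rw [lie_lie_swap b', lie_lie_swap b, add_lie, lie_lie_swap ⁅b, c⁆, ε', lie_zero, lie_zero,
      lie_zero, zero_lie, hb', hb'', ← lie_skew] at ε3
    linear_combination (norm := module) -ε3
  have dT020 := congrArg (fun x => ⁅x, c⁆) T020
  simp only [D020, zsmul_lie, D110, anti_c'] at dT020
  have T111 : ⁅⁅a', b'⁆, a'⁆ = 0 := by
    have h5 : (5 : ℤ) • ⁅⁅a', b'⁆, a'⁆ = 0 := by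
      linear_combination (norm := module) -Y1 + (4 : ℤ) • X1 + (4 : ℤ) • dT020
    have h9 : (6 : ℤ) • ⁅⁅a', b'⁆, a'⁆ = 0 := by
      linear_combination (norm := module) -ε3' + (3 : ℤ) • D020 + (3 : ℤ) • dT020
    linear_combination (norm := module) h9 - h5
  have T021 : ⁅⁅a, b''⁆, a'⁆ = 0 := by rw [dT020, T111, smul_zero]
  have dT010 := congrArg (fun x => ⁅x, c⁆) T010
  simp only [zsmul_lie, D100, anti_c'] at dT010
  have T200 := X0.trans T020
  obtain ⟨A, haA, hA, hA2⟩ := ha.class_two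
  have ha'A : a' ∈ A := ha' ▸ hA a haA c
  have tri : ∀ y ∈ A, ∀ z ∈ A, ∀ m : L, ⁅⁅⁅y, z⁆, m⁆, a⁆ = 0 := by
    intro y hy z hz m
    rw [lie_lie_swap, hA2 y hy z hz a haA, zero_lie, zero_add, ← lie_skew m a, lie_neg,
      hA2 y hy z hz _ (hA a haA m), neg_zero]
  exact
  { lie_c_T000 := anti_c' b
    lie_b_T000 := by
      refine h2 _ ?_
      linear_combination (norm := module) ha.anti b b
    lie_a_T000 := hA2 _ (hA a haA b) _ haA _ haA
    lie_b'_T000 := by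
      have h := ha.anti b b'
      rw [T010, zsmul_lie] at h
      linear_combination (norm := module) h
    lie_b''_T000 := by
      have h := ha.anti b b''
      rw [T020, zsmul_lie] at h
      linear_combination (norm := module) h
    T010 := T010
    T001 := by linear_combination (norm := module) s001
    T020 := T020
    T200 := T200
    T002 := by linear_combination (norm := module) s002 + T200
    T011 := by linear_combination (norm := module) s011 + dT010 - (2 : ℤ) • T200
    lie_c_α := by linear_combination (norm := module) D100 + T200
    lie_c_η := by
      rw [lie_lie_swap, ε', zero_lie, hb']
      linear_combination (norm := module) dT010 - (2 : ℤ) • T200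
    lie_c_τ := D110.trans T111
    lie_c_σ := by linear_combination (norm := module) D101 + (2 : ℤ) • X1 + T111 + s102 +
      (2 : ℤ) • T021
    lie_a_ε := hA2 _ haA _ ha'A _ haA
    lie_a_α := hA2 _ (hA _ ha'A _) _ haA _ haA
    lie_a_η := tri _ haA _ ha'A _
    lie_a_τ := hA2 _ (hA _ ha'A _) _ haA _ haA
    lie_a_σ := hA2 _ (hA _ ha'A _) _ ha'A _ haA
    lie_a_κ := tri _ (hA _ ha'A _) _ haA _ }

theorem lie_four_rotate (x y z w : L) :
    ⁅⁅⁅x, y⁆, z⁆, w⁆ + ⁅⁅⁅y, x⁆, w⁆, z⁆ + ⁅⁅⁅z, w⁆, x⁆, y⁆ + ⁅⁅⁅w, z⁆, y⁆, x⁆ = 0 := by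
  rw [lie_lie_swap ⁅x, y⁆ z w, lie_lie_swap ⁅z, w⁆ x y, ← lie_skew y x, ← lie_skew w z,
    ← lie_skew ⁅z, w⁆ ⁅x, y⁆]
  simp only [neg_lie]
  abel

/-- The additive span of the left-normed brackets of length `n + 1` in elements of `S`. -/
def bracketSpan (S : Set L) : ℕ → AddSubgroup L
  | 0 => AddSubgroup.closure S
  | n + 1 => AddSubgroup.closure {z | ∃ v ∈ bracketSpan S n, ∃ x ∈ S, z = ⁅v, x⁆}

theorem bracketSpan_succ_le {S T : Set L} {n : ℕ} {W : AddSubgroup L}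
    (h : bracketSpan S n ≤ AddSubgroup.closure T) (hT : ∀ t ∈ T, ∀ x ∈ S, ⁅t, x⁆ ∈ W) :
    bracketSpan S (n + 1) ≤ W := by
  rw [bracketSpan, AddSubgroup.closure_le]
  rintro _ ⟨v, hv, x, hx, rfl⟩
  replace hv := h hv
  induction hv using AddSubgroup.closure_induction with
  | mem t ht => exact hT t ht x hx
  | zero => rw [zero_lie]; exact W.zero_mem
  | add u v _ _ hu hv => rw [add_lie]; exact W.add_mem hu hv
  | neg u _ hu => rw [neg_lie]; exact W.neg_mem hu

theorem LieEngel.quadruple {S : Set L} {a a' a'' b b' b'' c α η τ σ αb ηb τb σb : L}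
    (h2 : ∀ x : L, (2 : ℤ) • x = 0 → x = 0) (ha : LieEngel S a) (hb : LieEngel S b)
    (hbS : b ∈ S) (hb' : ⁅b, c⁆ = b') (hb'' : ⁅b', c⁆ = b'')
    (hα : ⁅⁅a', b⁆, a⁆ = α) (hη : ⁅⁅a, a'⁆, b⁆ = η) (hσ : ⁅⁅a', b⁆, a'⁆ = σ)
    (P : LieTriple c a a' a'' b b' b'' α η τ σ)
    (Q : LieTriple c b b' b'' a a' a'' αb ηb τb σb) :
    ⁅η, b⁆ = (-2 : ℤ) • ⁅α, b⁆ ∧ (3 : ℤ) • ⁅α, b⁆ + (2 : ℤ) • ⁅αb, a⁆ = 0 ∧ ⁅τ, b⁆ = 0 ∧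
    ⁅σ, b⁆ = (2 : ℤ) • ⁅αb, a'⁆ ∧ ⁅σ, b⁆ = (-2 : ℤ) • ⁅α, b'⁆ ∧
    ⁅⁅α, b⁆, c⁆ = ⁅σ, b⁆ + ⁅α, b'⁆ := by
  have k1 : ⁅η, b⁆ = (-2 : ℤ) • ⁅α, b⁆ := by
    have h1 := lie_four_rotate a' b a b
    have h3 := hb.anti a a'
    rw [hα, P.T001, add_lie] at h1
    linear_combination (norm := module) h1 - h3
  have k2 : (3 : ℤ) • ⁅α, b⁆ + (2 : ℤ) • ⁅αb, a⁆ = 0 := by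
    have h1 := ha.linear b hbS a'
    rw [← lie_skew a b, neg_lie, neg_lie, Q.lie_b'_T000, neg_lie, neg_lie, ← neg_lie, ← neg_lie,
      lie_skew, P.T001, hη, add_lie, k1] at h1
    linear_combination (norm := module) -h1
  have t0 : ⁅τ, b⁆ = 0 := by
    have h1 := lie_four_rotate a'' b a b
    rw [P.T200, P.T002, Q.T020, Q.lie_b''_T000] at h1
    simp only [zsmul_lie] at h1
    refine h2 _ (h2 _ ?_)
    linear_combination (norm := module) -h1
  have s1 : ⁅σ, b⁆ = (2 : ℤ) • ⁅αb, a'⁆ := by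
    have h1 := lie_four_rotate a' b a' b
    rw [hσ, Q.T010] at h1
    simp only [zsmul_lie] at h1
    refine sub_eq_zero.1 (h2 _ ?_)
    linear_combination (norm := module) h1
  have d1 := congrArg (fun x => ⁅x, c⁆) k1
  have d2 := congrArg (fun x => ⁅x, c⁆) P.lie_b'_T000
  have dα : ⁅⁅α, b⁆, c⁆ = ⁅σ, b⁆ + ⁅α, b'⁆ := by
    rw [lie_lie_swap, P.lie_c_α, hb', sub_lie, t0, sub_zero]
  simp only [zsmul_lie, dα] at d1 d2
  rw [lie_lie_swap η, P.lie_c_η, hb', sub_lie, zsmul_lie, zsmul_lie, t0] at d1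
  rw [lie_lie_swap, P.lie_c_T000, hb'', P.lie_b''_T000, t0] at d2
  refine ⟨k1, k2, t0, s1, ?_, dα⟩
  refine sub_eq_zero.1 (h2 _ ?_)
  linear_combination (norm := module) d1 - d2

theorem LieEngel.bracketSpan_five {a b c : L} (h2 : ∀ x : L, (2 : ℤ) • x = 0 → x = 0)
    (ha : LieEngel {a, b, c} a) (hb : LieEngel {a, b, c} b) :
    bracketSpan {a, b, c} 5 ≤ ⊥ ∧ ⁅⁅⁅⁅a, c⁆, b⁆, c⁆, c⁆ = 0 := by
  have hc : c ∈ ({a, b, c} : Set L) := by simp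
  have haS : a ∈ ({a, b, c} : Set L) := by simp
  have hbS : b ∈ ({a, b, c} : Set L) := by simp
  have P := ha.triple h2 hb hc rfl rfl rfl rfl
  have Q := hb.triple h2 ha hc rfl rfl rfl rfl
  obtain ⟨hX, hY, h21, h12⟩ := ha.pair h2 hb hc
  obtain ⟨ε', h02, -⟩ := ha.adjoint h2 hc
  obtain ⟨εb', h02b, -⟩ := hb.adjoint h2 hc
  have a3 := ha.cube c hc
  have b3 := hb.cube c hc
  obtain ⟨k1, k2, t0, s1, s2, dκ⟩ := ha.quadruple h2 hb hbS rfl rfl rfl rfl rfl P Q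
  obtain ⟨k1b, k2b, t0b, s1b, s2b, dκb⟩ := hb.quadruple h2 ha haS rfl rfl rfl rfl rfl Q P
  generalize ha' : ⁅a, c⁆ = a' at *
  generalize ha'' : ⁅a', c⁆ = a'' at *
  generalize hb' : ⁅b, c⁆ = b' at *
  generalize hb'' : ⁅b', c⁆ = b'' at *
  have hτb : ⁅⁅a', b'⁆, b⁆ = -⁅⁅b', a'⁆, b⁆ := by rw [← lie_skew a' b', neg_lie]
  generalize hα : ⁅⁅a', b⁆, a⁆ = α at *
  generalize hη : ⁅⁅a, a'⁆, b⁆ = η at *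
  generalize hσ : ⁅⁅a', b⁆, a'⁆ = σ at *
  generalize hτ : ⁅⁅a', b'⁆, a⁆ = τ at *
  generalize hαb : ⁅⁅b', a⁆, b⁆ = αb at *
  generalize hηb : ⁅⁅b, b'⁆, a⁆ = ηb at *
  generalize hσb : ⁅⁅b', a⁆, b'⁆ = σb at *
  generalize ⁅⁅b', a'⁆, b⁆ = τb at *
  have κκ : ⁅αb, a⁆ = ⁅α, b⁆ := by linear_combination (norm := module) k2b - k2
  have mm : ⁅αb, a'⁆ = -⁅α, b'⁆ := by
    refine sub_eq_zero.1 (h2 _ ?_)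
    linear_combination (norm := module) s2 - s1
  have m0 : ⁅α, b'⁆ = 0 := by
    refine h2 _ ?_
    have := congrArg (fun x => ⁅x, c⁆) κκ
    simp only [dκ, dκb] at this
    linear_combination (norm := module) this + s2 - s1b - mm
  rw [m0, smul_zero] at s2 s1b
  rw [s2, m0, add_zero] at dκ
  have hab : ⁅b, a⁆ = -⁅a, b⁆ := (lie_skew b a).symm
  have S1 : bracketSpan {a, b, c} 1 ≤ AddSubgroup.closure {⁅a, b⁆, a', b'} := by
    refine bracketSpan_succ_le le_rfl ?_
    simp only [Set.mem_insert_iff, Set.mem_singleton_iff, forall_eq_or_imp, forall_eq]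
    rw [hab, ← lie_skew c a, ← lie_skew c b, ha', hb']
    simp only [lie_self]
    refine ⟨⟨?_, ?_, ?_⟩, ⟨?_, ?_, ?_⟩, ⟨?_, ?_, ?_⟩⟩ <;>
    repeat first | apply neg_mem | exact zero_mem _ | (apply AddSubgroup.subset_closure; simp)
  have S2 : bracketSpan {a, b, c} 2 ≤ AddSubgroup.closure
      {⁅⁅a, b⁆, a⁆, ⁅⁅b, a⁆, b⁆, ⁅a', b⁆, ⁅a, b'⁆, ⁅a, a'⁆, ⁅b, b'⁆, a'', b''} := by
    refine bracketSpan_succ_le S1 ?_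
    simp only [Set.mem_insert_iff, Set.mem_singleton_iff, forall_eq_or_imp, forall_eq]
    have h1 : ⁅⁅a, b⁆, b⁆ = -⁅⁅b, a⁆, b⁆ := by rw [hab, neg_lie, neg_neg]
    have h3 : ⁅⁅a, b⁆, c⁆ = ⁅a', b⁆ + ⁅a, b'⁆ := by rw [lie_lie_swap, ha', hb']
    rw [h1, h3, ← lie_skew a' a, ← lie_skew b' a, ← lie_skew b' b, ha'', hb'']
    refine ⟨⟨?_, ?_, ?_⟩, ⟨?_, ?_, ?_⟩, ⟨?_, ?_, ?_⟩⟩ <;>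
    repeat first | apply neg_mem | apply add_mem | (apply AddSubgroup.subset_closure; simp)
  have S3 : bracketSpan {a, b, c} 3 ≤ AddSubgroup.closure
      {α, η, αb, ηb, ⁅a'', b⁆, ⁅a', b'⁆} := by
    refine bracketSpan_succ_le S2 ?_
    simp only [Set.mem_insert_iff, Set.mem_singleton_iff, forall_eq_or_imp, forall_eq]
    have h1 : ⁅⁅a', b⁆, b⁆ = (2 : ℤ) • αb := by
      rw [← lie_skew a' b, neg_lie, Q.T010]; module
    have h3 : ⁅⁅a, b'⁆, b⁆ = -αb := by rw [← lie_skew a b', neg_lie, hαb]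
    have h4 : ⁅⁅a', b⁆, c⁆ = ⁅a'', b⁆ + ⁅a', b'⁆ := by rw [lie_lie_swap, ha'', hb']
    have h5 : ⁅⁅a, b'⁆, c⁆ = ⁅a', b'⁆ + ⁅a'', b⁆ := by rw [lie_lie_swap, ha', hb'', hX]
    have h6 : ⁅a'', a⁆ = 0 := by rw [← lie_skew, h02, neg_zero]
    have h7 : ⁅b'', b⁆ = 0 := by rw [← lie_skew, h02b, neg_zero]
    have h8 : ⁅b'', a⁆ = -⁅a'', b⁆ := by rw [← lie_skew, hX]
    rw [P.lie_a_T000, P.lie_b_T000, P.lie_c_T000, Q.lie_a_T000, Q.lie_b_T000, Q.lie_c_T000, hα,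
      h1, h4, P.T010, h3, h5, P.lie_a_ε, hη, ε', hηb, Q.lie_a_ε, εb', h6, a3, h8, h7, b3]
    refine ⟨⟨?_, ?_, ?_⟩, ⟨?_, ?_, ?_⟩, ⟨?_, ?_, ?_⟩, ⟨?_, ?_, ?_⟩, ⟨?_, ?_, ?_⟩, ⟨?_, ?_, ?_⟩,
      ⟨?_, ?_, ?_⟩, ⟨?_, ?_, ?_⟩⟩ <;>
    repeat first | apply neg_mem | apply add_mem | apply zsmul_mem | exact zero_mem _ |
      (apply AddSubgroup.subset_closure; simp)
  have hXc : ⁅⁅a'', b⁆, c⁆ = 0 := by rw [lie_lie_swap, a3, hb', h21, zero_lie, add_zero]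
  have hYc : ⁅⁅a', b'⁆, c⁆ = 0 := by rw [lie_lie_swap, ha'', hb'', h21, h12, add_zero]
  have S4 : bracketSpan {a, b, c} 4 ≤ AddSubgroup.closure {τ, σ, τb, σb, ⁅α, b⁆} := by
    refine bracketSpan_succ_le S3 ?_
    simp only [Set.mem_insert_iff, Set.mem_singleton_iff, forall_eq_or_imp, forall_eq]
    have h1 : ⁅⁅a'', b⁆, b⁆ = (2 : ℤ) • τb := by
      rw [← lie_skew a'' b, neg_lie, Q.T020]; module
    rw [P.lie_a_α, P.lie_c_α, P.lie_a_η, k1, P.lie_c_η, Q.lie_a_α, κκ, Q.lie_c_α, Q.lie_a_η, k1b,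
      κκ, Q.lie_c_η, P.T200, h1, hXc, hτ, hτb, hYc]
    refine ⟨⟨?_, ?_, ?_⟩, ⟨?_, ?_, ?_⟩, ⟨?_, ?_, ?_⟩, ⟨?_, ?_, ?_⟩, ⟨?_, ?_, ?_⟩,
      ⟨?_, ?_, ?_⟩⟩ <;>
    repeat first | apply neg_mem | apply sub_mem | apply zsmul_mem | exact zero_mem _ |
      (apply AddSubgroup.subset_closure; simp)
  refine ⟨bracketSpan_succ_le S4 ?_, ?_⟩
  · have h1 : ⁅⁅α, b⁆, b⁆ = 0 := by rw [← κκ]; exact Q.lie_a_κ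
    simp only [Set.mem_insert_iff, Set.mem_singleton_iff, forall_eq_or_imp, forall_eq,
      AddSubgroup.mem_bot]
    exact ⟨⟨P.lie_a_τ, t0, P.lie_c_τ⟩, ⟨P.lie_a_σ, s2, P.lie_c_σ⟩, ⟨t0b, Q.lie_a_τ, Q.lie_c_τ⟩,
      ⟨s1b, Q.lie_a_σ, Q.lie_c_σ⟩, ⟨P.lie_a_κ, h1, dκ⟩⟩
  · rw [lie_lie_swap a' b c, ha'', hb', add_lie, hXc, hYc, add_zero]

end LieRing

section Graded

variable {G : Type*} [Group G]

theorem groupComm_mul_left_mem {n : ℕ} {x y s : G} (h : groupComm x y ∈ gam G n) :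
    (groupComm x y * groupComm s y)⁻¹ * groupComm (x * s) y ∈ gam G (n + 1) := by
  have h1 : (groupComm x y * groupComm s y)⁻¹ * groupComm (x * s) y =
      (groupComm s y)⁻¹ * groupComm (groupComm x y) s * groupComm s y := by
    simp only [groupComm]; group
  rw [h1]
  simpa using (gam_normal (n + 1)).conj_mem _ (groupComm_mem_gam_succ h s) (groupComm s y)⁻¹

theorem groupComm_mul_right_mem {n : ℕ} {x y t : G} (h : groupComm x y ∈ gam G n)
    (h' : groupComm x t ∈ gam G n) :
    (groupComm x y * groupComm x t)⁻¹ * groupComm x (y * t) ∈ gam G (n + 1) := by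
  have h1 : (groupComm x y * groupComm x t)⁻¹ * groupComm x (y * t) =
      groupComm (groupComm x t) (groupComm x y) * groupComm (groupComm x y) t := by
    simp only [groupComm]; group
  rw [h1]
  exact mul_mem (groupComm_mem_gam_succ h' _) (groupComm_mem_gam_succ h t)

variable (G) in
/-- The factor `γₙ / γₙ₊₁` of the lower central series, written additively. -/
def GamFactor (n : ℕ) : Type _ := Additive (gam G n ⧸ (gam G (n + 1)).subgroupOf (gam G n))

instance gamFactorAddGroup (n : ℕ) : AddGroup (GamFactor G n) :=
  inferInstanceAs (AddGroup (Additive (gam G n ⧸ (gam G (n + 1)).subgroupOf (gam G n))))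

/-- The class of an element of `γₙ` in `γₙ / γₙ₊₁`. -/
def gamClass (n : ℕ) (x : gam G n) : GamFactor G n :=
  Additive.ofMul (QuotientGroup.mk x : gam G n ⧸ (gam G (n + 1)).subgroupOf (gam G n))

theorem gamClass_mul {n : ℕ} (x y : gam G n) : gamClass n (x * y) = gamClass n x + gamClass n y :=
  rfl

theorem gamClass_one (n : ℕ) : gamClass n (1 : gam G n) = 0 := rfl

theorem gamClass_surjective {n : ℕ} (p : GamFactor G n) : ∃ x, gamClass n x = p :=
  QuotientGroup.mk_surjective (s := (gam G (n + 1)).subgroupOf (gam G n)) p.toMul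

theorem gamClass_eq_iff {n : ℕ} {x y : gam G n} :
    gamClass n x = gamClass n y ↔ (x : G)⁻¹ * y ∈ gam G (n + 1) := by
  refine (Additive.ofMul.injective.eq_iff).trans (QuotientGroup.eq.trans ?_)
  rw [Subgroup.mem_subgroupOf]; rfl

theorem gamClass_eq_zero_iff {n : ℕ} {x : gam G n} :
    gamClass n x = 0 ↔ (x : G) ∈ gam G (n + 1) := by
  rw [← gamClass_one, eq_comm, gamClass_eq_iff]; simp

instance gamFactorAddCommGroup (n : ℕ) : AddCommGroup (GamFactor G n) :=
  { gamFactorAddGroup n with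
    add_comm := by
      intro p q
      obtain ⟨x, rfl⟩ := gamClass_surjective p
      obtain ⟨y, rfl⟩ := gamClass_surjective q
      rw [← gamClass_mul, ← gamClass_mul, gamClass_eq_iff]
      have h1 : ((x * y : gam G n) : G)⁻¹ * (y * x : gam G n) = groupComm (y : G) x := by
        simp only [groupComm, Subgroup.coe_mul]; group
      rw [h1]
      exact groupComm_mem_gam_succ y.2 _ }

/-- The commutator map `γᵢ × γⱼ → γᵢ₊ⱼ`. -/
def gamComm (i j : ℕ) (x : gam G i) (y : gam G j) : gam G (i + j) :=
  ⟨groupComm (x : G) y, groupComm_mem_gam x.2 y.2⟩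

theorem gamClass_gamComm_mul_left {i j : ℕ} (x s : gam G i) (y : gam G j) :
    gamClass (i + j) (gamComm i j (x * s) y) =
      gamClass (i + j) (gamComm i j x y) + gamClass (i + j) (gamComm i j s y) := by
  rw [← gamClass_mul, eq_comm, gamClass_eq_iff]
  exact groupComm_mul_left_mem (groupComm_mem_gam x.2 y.2)

theorem gamClass_gamComm_mul_right {i j : ℕ} (x : gam G i) (y t : gam G j) :
    gamClass (i + j) (gamComm i j x (y * t)) =
      gamClass (i + j) (gamComm i j x y) + gamClass (i + j) (gamComm i j x t) := by
  rw [← gamClass_mul, eq_comm, gamClass_eq_iff]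
  exact groupComm_mul_right_mem (groupComm_mem_gam x.2 y.2) (groupComm_mem_gam x.2 t.2)

/-- The commutator pairing on the factors of the lower central series. -/
def gamBracket (i j : ℕ) (p : GamFactor G i) (q : GamFactor G j) : GamFactor G (i + j) :=
  Quotient.liftOn₂' p.toMul q.toMul (fun x y => gamClass (i + j) (gamComm i j x y)) (by
    intro x y x' y' hx hy
    replace hx := QuotientGroup.leftRel_apply.1 hx
    replace hy := QuotientGroup.leftRel_apply.1 hy
    rw [Subgroup.mem_subgroupOf] at hx hy
    have e1 : x' = x * (x⁻¹ * x') := by group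
    have e2 : y' = y * (y⁻¹ * y') := by group
    rw [e1, gamClass_gamComm_mul_left, e2, gamClass_gamComm_mul_right]
    have z1 : gamClass (i + j) (gamComm i j x (y⁻¹ * y')) = 0 := by
      refine gamClass_eq_zero_iff.2 ?_
      have := groupComm_mem_gam x.2 hy
      rwa [← add_assoc] at this
    have z2 : gamClass (i + j) (gamComm i j (x⁻¹ * x') (y * (y⁻¹ * y'))) = 0 := by
      refine gamClass_eq_zero_iff.2 ?_
      have := groupComm_mem_gam hx (y * (y⁻¹ * y')).2
      rwa [show i + 1 + j = i + j + 1 by ring] at this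
    rw [z1, z2, add_zero, add_zero])

theorem gamBracket_add_left {i j : ℕ} (p p' : GamFactor G i) (q : GamFactor G j) :
    gamBracket i j (p + p') q = gamBracket i j p q + gamBracket i j p' q := by
  obtain ⟨x, rfl⟩ := gamClass_surjective p
  obtain ⟨x', rfl⟩ := gamClass_surjective p'
  obtain ⟨y, rfl⟩ := gamClass_surjective q
  exact gamClass_gamComm_mul_left x x' y

theorem gamBracket_add_right {i j : ℕ} (p : GamFactor G i) (q q' : GamFactor G j) :
    gamBracket i j p (q + q') = gamBracket i j p q + gamBracket i j p q' := by
  obtain ⟨x, rfl⟩ := gamClass_surjective p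
  obtain ⟨y, rfl⟩ := gamClass_surjective q
  obtain ⟨y', rfl⟩ := gamClass_surjective q'
  exact gamClass_gamComm_mul_right x y y'

instance gamFactorGMul : DirectSum.GNonUnitalNonAssocSemiring (GamFactor G) where
  mul {i j} p q := gamBracket i j p q
  mul_zero {i j} p := by
    have h := gamBracket_add_right p (0 : GamFactor G j) 0
    rwa [add_zero, left_eq_add] at h
  zero_mul {i j} q := by
    have h := gamBracket_add_left (0 : GamFactor G i) 0 q
    rwa [add_zero, left_eq_add] at h
  mul_add := gamBracket_add_right
  add_mul := gamBracket_add_left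

variable (G) in
/-- The graded Lie ring `⨁ γₙ / γₙ₊₁` of the lower central series. -/
def GradedLie : Type _ := ⨁ n, GamFactor G n

instance gradedLieAddCommGroup : AddCommGroup (GradedLie G) :=
  inferInstanceAs (AddCommGroup (⨁ n, GamFactor G n))

instance gradedLieBracket : Bracket (GradedLie G) (GradedLie G) where
  bracket p q := (show ⨁ n, GamFactor G n from p) * (show ⨁ n, GamFactor G n from q)

open scoped Classical in
/-- The symbol of degree `n` of an element of `γₙ`, with value `0` outside `γₙ`. -/
noncomputable def gradedSymbol (n : ℕ) (x : G) : GradedLie G :=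
  if h : x ∈ gam G n then DirectSum.of (GamFactor G) n (gamClass n ⟨x, h⟩) else 0

theorem gradedSymbol_eq {n : ℕ} {x : G} (h : x ∈ gam G n) :
    gradedSymbol n x = DirectSum.of (GamFactor G) n (gamClass n ⟨x, h⟩) := dif_pos h

theorem gradedSymbol_mul {n : ℕ} {x y : G} (hx : x ∈ gam G n) (hy : y ∈ gam G n) :
    gradedSymbol n (x * y) = gradedSymbol n x + gradedSymbol n y := by
  rw [gradedSymbol_eq hx, gradedSymbol_eq hy, gradedSymbol_eq (mul_mem hx hy)]
  exact (DirectSum.of (GamFactor G) n).map_add (gamClass n ⟨x, hx⟩) (gamClass n ⟨y, hy⟩)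

theorem gradedSymbol_eq_zero_iff {n : ℕ} {x : G} (hx : x ∈ gam G n) :
    gradedSymbol n x = 0 ↔ x ∈ gam G (n + 1) := by
  rw [gradedSymbol_eq hx]
  refine Iff.trans ?_ (gamClass_eq_zero_iff (x := ⟨x, hx⟩))
  exact map_eq_zero_iff (DirectSum.of (GamFactor G) n) (DirectSum.of_injective n)

theorem gradedSymbol_lie {i j : ℕ} {x y : G} (hx : x ∈ gam G i) (hy : y ∈ gam G j) :
    ⁅gradedSymbol i x, gradedSymbol j y⁆ = gradedSymbol (i + j) (groupComm x y) := by
  rw [gradedSymbol_eq hx, gradedSymbol_eq hy, gradedSymbol_eq (groupComm_mem_gam hx hy)]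
  exact DirectSum.of_mul_of _ _

theorem GradedLie.induction {p : GradedLie G → Prop} (zero : p 0)
    (symbol : ∀ n, ∀ x ∈ gam G n, p (gradedSymbol n x)) (add : ∀ u v, p u → p v → p (u + v))
    (u : GradedLie G) : p u := by
  refine DirectSum.induction_on (motive := p) u zero ?_ add
  intro n q
  obtain ⟨x, rfl⟩ := gamClass_surjective q
  have := symbol n x x.2
  rwa [gradedSymbol_eq x.2] at this

theorem gradedLie_add_lie (u v w : GradedLie G) : ⁅u + v, w⁆ = ⁅u, w⁆ + ⁅v, w⁆ :=
  add_mul (show ⨁ n, GamFactor G n from u) v w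

theorem gradedLie_lie_add (u v w : GradedLie G) : ⁅u, v + w⁆ = ⁅u, v⁆ + ⁅u, w⁆ :=
  mul_add (show ⨁ n, GamFactor G n from u) v w

theorem gradedLie_zero_lie (u : GradedLie G) : ⁅(0 : GradedLie G), u⁆ = 0 :=
  zero_mul (show ⨁ n, GamFactor G n from u)

theorem gradedLie_lie_zero (u : GradedLie G) : ⁅u, (0 : GradedLie G)⁆ = 0 :=
  mul_zero (show ⨁ n, GamFactor G n from u)

theorem gradedSymbol_one (n : ℕ) : gradedSymbol n (1 : G) = 0 :=
  (gradedSymbol_eq_zero_iff (one_mem _)).2 (one_mem _)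

theorem gradedSymbol_inv {n : ℕ} {x : G} (hx : x ∈ gam G n) :
    gradedSymbol n x⁻¹ = -gradedSymbol n x := by
  rw [eq_neg_iff_add_eq_zero, ← gradedSymbol_mul (inv_mem hx) hx, inv_mul_cancel, gradedSymbol_one]

theorem gradedSymbol_conj {n : ℕ} {x : G} (hx : x ∈ gam G n) (g : G) :
    gradedSymbol n (g⁻¹ * x * g) = gradedSymbol n x := by
  have h := groupComm_mem_gam_succ hx g
  rw [← mul_groupComm, gradedSymbol_mul hx (gam_le (Nat.le_succ n) h),
    (gradedSymbol_eq_zero_iff (gam_le (Nat.le_succ n) h)).2 h, add_zero]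

theorem gradedLie_lie_skew (u v : GradedLie G) : ⁅u, v⁆ + ⁅v, u⁆ = 0 := by
  induction u using GradedLie.induction with
  | zero => rw [gradedLie_zero_lie, gradedLie_lie_zero, add_zero]
  | add u u' hu hu' =>
    rw [gradedLie_add_lie, gradedLie_lie_add, add_add_add_comm, hu, hu', add_zero]
  | symbol i x hx =>
    induction v using GradedLie.induction with
    | zero => rw [gradedLie_zero_lie, gradedLie_lie_zero, add_zero]
    | add u u' hu hu' =>
      rw [gradedLie_add_lie, gradedLie_lie_add, add_add_add_comm, hu, hu', add_zero]
    | symbol j y hy =>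
      rw [gradedSymbol_lie hx hy, gradedSymbol_lie hy hx, add_comm j i, ← groupComm_inv x y,
        gradedSymbol_inv (groupComm_mem_gam hx hy), add_neg_cancel]

theorem gradedLie_lie_self (u : GradedLie G) : ⁅u, u⁆ = 0 := by
  induction u using GradedLie.induction with
  | zero => rw [gradedLie_zero_lie]
  | add u u' hu hu' =>
    rw [gradedLie_add_lie, gradedLie_lie_add, gradedLie_lie_add, hu, hu', zero_add, add_zero,
      gradedLie_lie_skew]
  | symbol i x hx =>
    rw [gradedSymbol_lie hx hx, groupComm_eq_one_iff.2 (Commute.refl x), gradedSymbol_one]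

theorem gradedLie_neg_lie (u v : GradedLie G) : ⁅-u, v⁆ = -⁅u, v⁆ := by
  rw [eq_neg_iff_add_eq_zero, ← gradedLie_add_lie, neg_add_cancel, gradedLie_zero_lie]

theorem gradedLie_lie_neg (u v : GradedLie G) : ⁅u, -v⁆ = -⁅u, v⁆ := by
  rw [eq_neg_iff_add_eq_zero, ← gradedLie_lie_add, neg_add_cancel, gradedLie_lie_zero]

theorem gradedLie_jacobi (u v w : GradedLie G) :
    ⁅⁅u, v⁆, w⁆ + ⁅⁅v, w⁆, u⁆ + ⁅⁅w, u⁆, v⁆ = 0 := by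
  have arr : ∀ A B C A' B' C' : GradedLie G, A + A' + (B + B') + (C + C') =
      A + B + C + (A' + B' + C') := fun _ _ _ _ _ _ => by abel
  induction u using GradedLie.induction with
  | zero => simp only [gradedLie_zero_lie, gradedLie_lie_zero, add_zero]
  | add u u' hu hu' =>
    simp only [gradedLie_add_lie, gradedLie_lie_add]
    rw [arr, hu, hu', add_zero]
  | symbol i x hx =>
    induction v using GradedLie.induction with
    | zero => simp only [gradedLie_zero_lie, gradedLie_lie_zero, add_zero]
    | add u u' hu hu' =>
      simp only [gradedLie_add_lie, gradedLie_lie_add]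
      rw [arr, hu, hu', add_zero]
    | symbol j y hy =>
      induction w using GradedLie.induction with
      | zero => simp only [gradedLie_zero_lie, gradedLie_lie_zero, add_zero]
      | add u u' hu hu' =>
        simp only [gradedLie_add_lie, gradedLie_lie_add]
        rw [arr, hu, hu', add_zero]
      | symbol k z hz =>
        have key : ∀ {i j k : ℕ} {x y z : G} (hx : x ∈ gam G i) (hy : y ∈ gam G j)
            (hz : z ∈ gam G k),
            gradedSymbol (i + j + k) (y⁻¹ * groupComm (groupComm x y⁻¹) z * y) =
              -⁅⁅gradedSymbol i x, gradedSymbol j y⁆, gradedSymbol k z⁆ := by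
          intro i j k x y z hx hy hz
          have h1 := groupComm_mem_gam hx (inv_mem hy)
          rw [gradedSymbol_conj (groupComm_mem_gam h1 hz), ← gradedSymbol_lie h1 hz,
            ← gradedSymbol_lie hx (inv_mem hy), gradedSymbol_inv hy, gradedLie_lie_neg,
            gradedLie_neg_lie]
        have mem : ∀ {i j k : ℕ} {x y z : G} (hx : x ∈ gam G i) (hy : y ∈ gam G j)
            (hz : z ∈ gam G k), y⁻¹ * groupComm (groupComm x y⁻¹) z * y ∈ gam G (i + j + k) := by
          intro i j k x y z hx hy hz
          simpa using (gam_normal (i + j + k)).conj_mem _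
            (groupComm_mem_gam (groupComm_mem_gam hx (inv_mem hy)) hz) y⁻¹
        have k1 := key hx hy hz
        have k2 := key hy hz hx
        have k3 := key hz hx hy
        have m1 := mem hx hy hz
        have m2 := mem hy hz hx
        have m3 := mem hz hx hy
        rw [show j + k + i = i + j + k by ring] at k2 m2
        rw [show k + i + j = i + j + k by ring] at k3 m3
        have hw : y⁻¹ * groupComm (groupComm x y⁻¹) z * y *
            (z⁻¹ * groupComm (groupComm y z⁻¹) x * z) *
            (x⁻¹ * groupComm (groupComm z x⁻¹) y * x) = 1 := by
          simp only [groupComm]; group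
        have h := gradedSymbol_one (G := G) (i + j + k)
        rw [← hw, gradedSymbol_mul (mul_mem m1 m2) m3, gradedSymbol_mul m1 m2, k1, k2, k3] at h
        rw [← neg_eq_zero, ← h]
        abel

instance gradedLieRing : LieRing (GradedLie G) where
  add_lie := gradedLie_add_lie
  lie_add := gradedLie_lie_add
  lie_self := gradedLie_lie_self
  leibniz_lie u v w := by
    have h := gradedLie_jacobi u v w
    have h1 := gradedLie_lie_skew ⁅v, w⁆ u
    have h2 : ⁅⁅w, u⁆, v⁆ = ⁅v, ⁅u, w⁆⁆ := by
      have h3 := gradedLie_lie_skew ⁅u, w⁆ v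
      rw [eq_neg_of_add_eq_zero_left (gradedLie_lie_skew w u), gradedLie_neg_lie]
      rw [eq_neg_of_add_eq_zero_left h3, neg_neg]
    rw [h2, eq_neg_of_add_eq_zero_left h1] at h
    rw [← sub_eq_zero, ← neg_eq_zero, ← h]
    abel

end Graded

section TorsionQuotient

/-- The ideal of elements of `2`-power order in a Lie ring. -/
def twoTorsion (L : Type*) [LieRing L] : LieIdeal ℤ L where
  carrier := {x | ∃ k : ℕ, (2 ^ k : ℤ) • x = 0}
  zero_mem' := ⟨0, smul_zero _⟩
  add_mem' := by
    rintro x y ⟨k, hk⟩ ⟨l, hl⟩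
    refine ⟨k + l, ?_⟩
    rw [smul_add, pow_add, mul_smul, smul_comm, hk, smul_zero, mul_smul, hl, smul_zero, add_zero]
  smul_mem' := by
    rintro m x ⟨k, hk⟩
    exact ⟨k, by rw [smul_comm, hk, smul_zero]⟩
  lie_mem := by
    rintro x y ⟨k, hk⟩
    exact ⟨k, by rw [← lie_zsmul, hk, lie_zero]⟩

variable {G : Type*} [Group G]

variable (G) in
/-- The graded Lie ring of the lower central series modulo its `2`-torsion. -/
abbrev LowerLie : Type _ := GradedLie G ⧸ twoTorsion (GradedLie G)

theorem LowerLie.two_torsionFree (x : LowerLie G) (h : (2 : ℤ) • x = 0) : x = 0 := by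
  obtain ⟨u, rfl⟩ := LieSubmodule.Quotient.surjective_mk' (twoTorsion (GradedLie G)) x
  rw [← map_zsmul, LieSubmodule.Quotient.mk'_apply, LieSubmodule.Quotient.mk_eq_zero'] at h
  obtain ⟨k, hk⟩ := h
  rw [LieSubmodule.Quotient.mk'_apply, LieSubmodule.Quotient.mk_eq_zero']
  exact ⟨k + 1, by rw [pow_succ, mul_smul, hk]⟩

/-- The symbol of degree `n` of an element of `γₙ`, modulo `2`-torsion. -/
noncomputable def symb (n : ℕ) (x : G) : LowerLie G :=
  LieSubmodule.Quotient.mk (N := twoTorsion (GradedLie G)) (gradedSymbol n x)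

theorem symb_mul {n : ℕ} {x y : G} (hx : x ∈ gam G n) (hy : y ∈ gam G n) :
    symb n (x * y) = symb n x + symb n y := by
  rw [symb, gradedSymbol_mul hx hy]; rfl

theorem symb_lie {i j : ℕ} {x y : G} (hx : x ∈ gam G i) (hy : y ∈ gam G j) :
    ⁅symb i x, symb j y⁆ = symb (i + j) (groupComm x y) := by
  rw [symb, symb, symb, ← gradedSymbol_lie hx hy]; rfl

theorem symb_eq_zero {n : ℕ} {x : G} (hx : x ∈ gam G (n + 1)) : symb n x = 0 := by
  rw [symb, (gradedSymbol_eq_zero_iff (gam_le (Nat.le_succ n) hx)).2 hx]; rfl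

theorem symb_one (n : ℕ) : symb n (1 : G) = 0 := symb_eq_zero (one_mem _)

theorem symb_inv {n : ℕ} {x : G} (hx : x ∈ gam G n) : symb n x⁻¹ = -symb n x := by
  rw [symb, gradedSymbol_inv hx]; rfl

theorem symb_mul_of_mem {n : ℕ} {x y : G} (hx : x ∈ gam G n) (hy : y ∈ gam G (n + 1)) :
    symb n (x * y) = symb n x := by
  rw [symb_mul hx (gam_le (Nat.le_succ n) hy), symb_eq_zero hy, add_zero]

theorem gradedSymbol_pow {n : ℕ} {x : G} (hx : x ∈ gam G n) (m : ℕ) :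
    gradedSymbol n (x ^ m) = (m : ℤ) • gradedSymbol n x := by
  induction m with
  | zero => rw [pow_zero, gradedSymbol_one, Nat.cast_zero, zero_smul]
  | succ m ih =>
    rw [pow_succ, gradedSymbol_mul (pow_mem hx m) hx, ih, Nat.cast_succ, add_smul, one_smul]

theorem exists_pow_mem_of_symb_eq_zero {n : ℕ} {x : G} (hx : x ∈ gam G n) (h : symb n x = 0) :
    ∃ k, x ^ (2 ^ k) ∈ gam G (n + 1) := by
  rw [symb, LieSubmodule.Quotient.mk_eq_zero'] at h
  obtain ⟨k, hk⟩ := h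
  refine ⟨k, (gradedSymbol_eq_zero_iff (pow_mem hx _)).1 ?_⟩
  rw [gradedSymbol_pow hx, ← hk]
  push_cast
  rfl

theorem LowerLie.induction {p : LowerLie G → Prop} (zero : p 0)
    (symbol : ∀ n, ∀ x ∈ gam G n, p (symb n x)) (add : ∀ u v, p u → p v → p (u + v))
    (u : LowerLie G) : p u := by
  obtain ⟨u, rfl⟩ := LieSubmodule.Quotient.surjective_mk' (twoTorsion (GradedLie G)) u
  induction u using GradedLie.induction with
  | zero => rwa [map_zero]
  | symbol n x hx => exact symbol n x hx
  | add u v hu hv => rw [map_add]; exact add _ _ hu hv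

theorem lie_mem_bracketSpan_succ {L : Type*} [LieRing L] {S : Set L} {n : ℕ} {v w : L}
    (hv : v ∈ bracketSpan S n) (hw : w ∈ AddSubgroup.closure S) :
    ⁅v, w⁆ ∈ bracketSpan S (n + 1) := by
  induction hw using AddSubgroup.closure_induction with
  | mem x hx => exact AddSubgroup.subset_closure ⟨v, hv, x, hx, rfl⟩
  | zero => rw [lie_zero]; exact zero_mem _
  | add x y _ _ hx hy => rw [lie_add]; exact add_mem hx hy
  | neg x _ hx => rw [lie_neg]; exact neg_mem hx

theorem symb_mem_bracketSpan {a b c : G} (hG : Subgroup.closure {a, b, c} = ⊤) (n : ℕ) {x : G}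
    (hx : x ∈ gam G (n + 1)) : symb (n + 1) x ∈ bracketSpan {symb 1 a, symb 1 b, symb 1 c} n := by
  have h1 : ∀ x : G, symb 1 x ∈ bracketSpan {symb 1 a, symb 1 b, symb 1 c} 0 := by
    intro x
    have hx : x ∈ Subgroup.closure {a, b, c} := hG ▸ Subgroup.mem_top x
    induction hx using Subgroup.closure_induction with
    | mem x hx =>
      refine AddSubgroup.subset_closure ?_
      rcases hx with rfl | rfl | rfl <;> simp
    | one => rw [symb_one]; exact zero_mem _
    | mul x y _ _ hx hy => rw [symb_mul (mem_gam_one x) (mem_gam_one y)]; exact add_mem hx hy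
    | inv x _ hx => rw [symb_inv (mem_gam_one x)]; exact neg_mem hx
  induction n generalizing x with
  | zero => exact h1 x
  | succ n ih =>
    rw [gam_succ_succ, Subgroup.commutator_def] at hx
    induction hx using Subgroup.closure_induction with
    | mem x hx =>
      obtain ⟨u, hu, g, -, rfl⟩ := hx
      have h2 : ⁅u, g⁆ = groupComm u⁻¹ g⁻¹ := by simp [groupComm, commutatorElement_def]
      rw [h2, ← symb_lie (inv_mem hu) (mem_gam_one g⁻¹)]
      exact lie_mem_bracketSpan_succ (ih (inv_mem hu)) (h1 g⁻¹)
    | one => rw [symb_one]; exact zero_mem _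
    | mul x y hx' hy' hx hy =>
      rw [← Subgroup.commutator_def, ← gam_succ_succ] at hx' hy'
      rw [symb_mul hx' hy']; exact add_mem hx hy
    | inv x hx' hx =>
      rw [← Subgroup.commutator_def, ← gam_succ_succ] at hx'
      rw [symb_inv hx']; exact neg_mem hx

end TorsionQuotient

section Linearize

variable {G : Type*} [Group G]

theorem anti_of_commute {a u v : G}
    (huv : Commute (groupComm (groupComm a (u * v)) a) (u * v))
    (hu : Commute (groupComm (groupComm a u) a) u) (hv : Commute (groupComm (groupComm a v) a) v)
    (h1 : Commute (groupComm (groupComm a v) a) (groupComm a u * groupComm (groupComm a u) v))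
    (h2 : Commute (groupComm (groupComm a u) a) (groupComm (groupComm a u) v))
    (h3 : ∀ g, Commute (groupComm (groupComm (groupComm a u) v) a) g)
    (h4 : ∀ g, Commute (groupComm (groupComm (groupComm a v) a) u) g) :
    groupComm (groupComm (groupComm a v) a) u * groupComm (groupComm (groupComm a u) a) v = 1 := by
  have e1 : groupComm a (u * v) = groupComm a v * groupComm a u * groupComm (groupComm a u) v := by
    simp only [groupComm]; group
  have e2 : ∀ s t r : G, groupComm (s * t * r) a =
      (t * r)⁻¹ * groupComm s a * (t * r) * (r⁻¹ * groupComm t a * r) * groupComm r a := by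
    intro s t r; simp only [groupComm]; group
  have cj : ∀ {x y : G}, Commute x y → y⁻¹ * x * y = x := by
    intro x y h; rw [mul_assoc, h.eq, inv_mul_cancel_left]
  rw [e1, e2, cj h1, cj h2] at huv
  generalize groupComm (groupComm (groupComm a u) v) a = z at *
  generalize groupComm (groupComm a u) a = eu at *
  generalize groupComm (groupComm a v) a = ev at *
  have h5 : Commute (ev * eu) (u * v) := by
    have := huv.mul_left (h3 (u * v)).inv_left
    rwa [mul_inv_cancel_right] at this
  have r1 : ev * u = u * (ev * groupComm ev u) := mul_groupComm_right ev u
  have r2 : eu * v = v * (eu * groupComm eu v) := mul_groupComm_right eu v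
  have h6 : u * v * (ev * eu) * (groupComm ev u * groupComm eu v) = u * v * (ev * eu) := by
    calc _ = u * (v * ev) * eu * groupComm ev u * groupComm eu v := by group
      _ = u * ev * v * (groupComm ev u * eu) * groupComm eu v := by
        rw [← hv.eq, (h4 eu).eq]; group
      _ = u * ev * (groupComm ev u * v) * eu * groupComm eu v := by rw [(h4 v).eq]; group
      _ = ev * u * v * eu * groupComm eu v := by rw [r1]; group
      _ = ev * (u * eu) * v := by
        rw [show ev * u * v * eu * groupComm eu v = ev * u * (v * (eu * groupComm eu v)) by group,
          ← r2]
        group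
      _ = ev * eu * (u * v) := by rw [← hu.eq]; group
      _ = _ := h5.eq
  exact mul_eq_left.1 h6

theorem linear_of_commute {a u v : G}
    (huv : Commute (groupComm (groupComm a (u * v)) (u * v)) (u * v))
    (hu : Commute (groupComm (groupComm a u) u) u)
    (h1 : ∀ g, Commute (groupComm (groupComm a v) v) g)
    (h2 : Commute (groupComm (groupComm a v) u) v)
    (h3 : Commute (groupComm (groupComm a v) u) (groupComm a u * groupComm (groupComm a u) v))
    (h4 : ∀ g, Commute (groupComm (groupComm (groupComm a u) u) v) g)
    (h5 : Commute (groupComm (groupComm a u) u) (groupComm (groupComm a u) v))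
    (h6 : ∀ g, Commute (groupComm (groupComm (groupComm a u) v) (u * v)) g)
    (h7 : Commute (groupComm (groupComm a u) v) v)
    (h8 : ∀ g, Commute (groupComm (groupComm (groupComm a v) u) u) g)
    (h9 : ∀ g, Commute (groupComm (groupComm (groupComm a u) v) u) g) :
    groupComm (groupComm (groupComm a v) u) u * groupComm (groupComm (groupComm a u) v) u *
      groupComm (groupComm (groupComm a u) u) v = 1 := by
  have e1 : groupComm a (u * v) = groupComm a v * groupComm a u * groupComm (groupComm a u) v := by
    simp only [groupComm]; group
  have e2 : ∀ s t r : G, groupComm (s * t * r) (u * v) =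
      (t * r)⁻¹ * (groupComm s v * (v⁻¹ * groupComm s u * v)) * (t * r) *
      (r⁻¹ * (groupComm t v * (groupComm t u * groupComm (groupComm t u) v)) * r) *
      groupComm r (u * v) := by
    intro s t r; simp only [groupComm]; group
  have cj : ∀ {x y : G}, Commute x y → y⁻¹ * x * y = x := by
    intro x y h; rw [mul_assoc, h.eq, inv_mul_cancel_left]
  have cc : Commute (groupComm (groupComm a v) v * groupComm (groupComm a v) u)
      (groupComm a u * groupComm (groupComm a u) v) := (h1 _).mul_left h3
  have cd : Commute (groupComm (groupComm a u) v * (groupComm (groupComm a u) u *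
      groupComm (groupComm (groupComm a u) u) v)) (groupComm (groupComm a u) v) :=
    (Commute.refl _).mul_left (h5.mul_left (h4 _))
  rw [e1, e2, cj h2, cj cc, cj cd] at huv
  generalize groupComm (groupComm (groupComm a u) v) (u * v) = z at *
  generalize groupComm (groupComm a v) v = y at *
  generalize groupComm (groupComm a u) v = r at *
  generalize groupComm (groupComm a u) u = w at *
  generalize groupComm (groupComm a v) u = s at *
  have h10 : Commute (s * r * w) (u * v) := by
    have := ((h1 (u * v)).inv_left.mul_left huv).mul_left
      ((h6 (u * v)).inv_left.mul_left (h4 (u * v)).inv_left)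
    rwa [show y⁻¹ * (y * s * (r * (w * groupComm w v)) * z) * (z⁻¹ * (groupComm w v)⁻¹) =
      s * r * w by group] at this
  have r1 : s * u = u * (s * groupComm s u) := mul_groupComm_right s u
  have r2 : r * u = u * (r * groupComm r u) := mul_groupComm_right r u
  have r3 : w * v = v * (w * groupComm w v) := mul_groupComm_right w v
  generalize groupComm s u = zs at *
  generalize groupComm r u = zr at *
  generalize groupComm w v = zw at *
  have h11 : s * r * w * (u * v) = u * v * (s * r * w) * (zs * zr * zw) := by
    simp only [mul_assoc, mul_eq_mul_assoc hu.eq, r3, mul_eq_mul_assoc r1,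
      mul_eq_mul_assoc r2, mul_eq_mul_assoc h7.eq,
      mul_eq_mul_assoc h2.eq, mul_eq_mul_assoc (h8 r).eq, mul_eq_mul_assoc (h8 w).eq,
      mul_eq_mul_assoc (h8 v).eq, mul_eq_mul_assoc (h9 w).eq, mul_eq_mul_assoc (h9 v).eq]
  rw [h10.eq] at h11
  exact left_eq_mul.1 h11

theorem commute_mk_of_mem {n : ℕ} {x y : G} (h : groupComm x y ∈ gam G n) :
    Commute (QuotientGroup.mk' (gam G n) x) (QuotientGroup.mk' (gam G n) y) := by
  rw [← groupComm_eq_one_iff, ← map_groupComm, ← MonoidHom.mem_ker, QuotientGroup.ker_mk']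
  exact h

theorem groupComm_mem_gam_of_le {i j n : ℕ} {x y : G} (hx : x ∈ gam G i) (hy : y ∈ gam G j)
    (h : n ≤ i + j) : groupComm x y ∈ gam G n := gam_le h (groupComm_mem_gam hx hy)

theorem symb_anti {a : G} (ha : ∀ g, Commute (groupComm (groupComm a g) a) g) {i j : ℕ}
    (hi : 1 ≤ i) {u v : G} (hu : u ∈ gam G i) (hv : v ∈ gam G j) :
    ⁅⁅⁅symb 1 a, symb i u⁆, symb 1 a⁆, symb j v⁆ +
      ⁅⁅⁅symb 1 a, symb j v⁆, symb 1 a⁆, symb i u⁆ = 0 := by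
  have a1 := mem_gam_one a
  have au := groupComm_mem_gam a1 hu
  have av := groupComm_mem_gam a1 hv
  have aua := groupComm_mem_gam au a1
  have ava := groupComm_mem_gam av a1
  have auav := groupComm_mem_gam aua hv
  have avau := groupComm_mem_gam ava hu
  have auv := groupComm_mem_gam au hv
  rw [symb_lie a1 hu, symb_lie au a1, symb_lie aua hv, symb_lie a1 hv, symb_lie av a1,
    symb_lie ava hu]
  rw [show 1 + i + 1 + j = 1 + j + 1 + i by ring] at auav ⊢
  rw [add_comm, ← symb_mul avau auav]
  refine symb_eq_zero ?_
  set n := 1 + j + 1 + i + 1 with hn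
  have hc : ∀ {k : ℕ} {z : G}, z ∈ gam G k → n ≤ k + 1 → ∀ q,
      Commute (QuotientGroup.mk' (gam G n) z) q := by
    intro k z hz hk q
    obtain ⟨g, rfl⟩ := QuotientGroup.mk'_surjective _ q
    exact commute_mk_of_mem (groupComm_mem_gam_of_le hz (mem_gam_one g) hk)
  have key := anti_of_commute (a := QuotientGroup.mk' (gam G n) a)
    (u := QuotientGroup.mk' (gam G n) u) (v := QuotientGroup.mk' (gam G n) v)
  simp only [← map_groupComm, ← map_mul] at key
  rw [← QuotientGroup.ker_mk' (gam G n), MonoidHom.mem_ker]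
  refine key ((ha _).map _) ((ha _).map _) ((ha _).map _) ?_ ?_ ?_ ?_
  · refine commute_mk_of_mem (groupComm_mem_gam_of_le ava
      (mul_mem au (gam_le (Nat.le_add_right _ j) auv)) (by omega))
  · exact commute_mk_of_mem (groupComm_mem_gam_of_le aua auv (by omega))
  · exact hc (groupComm_mem_gam auv a1) (by omega)
  · exact hc avau (by omega)

theorem symb_linear_of_two_le {a : G} (ha : a ∈ rightEngel 3 G) {j : ℕ} (hj : 2 ≤ j) (u : G)
    {v : G} (hv : v ∈ gam G j) :
    ⁅⁅⁅symb 1 a, symb 1 u⁆, symb 1 u⁆, symb j v⁆ + ⁅⁅⁅symb 1 a, symb 1 u⁆, symb j v⁆, symb 1 u⁆ +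
      ⁅⁅⁅symb 1 a, symb j v⁆, symb 1 u⁆, symb 1 u⁆ = 0 := by
  have a1 := mem_gam_one a
  have hu := mem_gam_one u
  have au := groupComm_mem_gam a1 hu
  have av := groupComm_mem_gam a1 hv
  have auu := groupComm_mem_gam au hu
  have auv := groupComm_mem_gam au hv
  have avu := groupComm_mem_gam av hu
  have auuv := groupComm_mem_gam auu hv
  have auvu := groupComm_mem_gam auv hu
  have avuu := groupComm_mem_gam avu hu
  rw [symb_lie a1 hu, symb_lie au hu, symb_lie auu hv, symb_lie au hv, symb_lie auv hu,
    symb_lie a1 hv, symb_lie av hu, symb_lie avu hu]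
  rw [show 1 + 1 + 1 + j = 1 + j + 1 + 1 by ring] at auuv ⊢
  rw [show 1 + 1 + j + 1 = 1 + j + 1 + 1 by ring] at auvu ⊢
  rw [add_comm, add_comm (symb _ (groupComm (groupComm (groupComm a u) u) v)), ← add_assoc,
    ← symb_mul avuu auvu, ← symb_mul (mul_mem avuu auvu) auuv]
  refine symb_eq_zero ?_
  set n := 1 + j + 1 + 1 + 1 with hn
  have hc : ∀ {k : ℕ} {z : G}, z ∈ gam G k → n ≤ k + 1 → ∀ q,
      Commute (QuotientGroup.mk' (gam G n) z) q := by
    intro k z hz hk q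
    obtain ⟨g, rfl⟩ := QuotientGroup.mk'_surjective _ q
    exact commute_mk_of_mem (groupComm_mem_gam_of_le hz (mem_gam_one g) hk)
  have key := linear_of_commute (a := QuotientGroup.mk' (gam G n) a)
    (u := QuotientGroup.mk' (gam G n) u) (v := QuotientGroup.mk' (gam G n) v)
  have hE : ∀ g, Commute (groupComm (groupComm a g) g) g := fun g => groupComm_eq_one_iff.1 (ha g)
  simp only [← map_groupComm, ← map_mul] at key
  rw [← QuotientGroup.ker_mk' (gam G n), MonoidHom.mem_ker]
  refine key ((hE _).map _) ((hE _).map _) ?_ ?_ ?_ ?_ ?_ ?_ ?_ ?_ ?_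
  · exact hc (groupComm_mem_gam av hv) (by omega)
  · exact commute_mk_of_mem (groupComm_mem_gam_of_le avu hv (by omega))
  · refine commute_mk_of_mem (groupComm_mem_gam_of_le avu
      (mul_mem au (gam_le (Nat.le_add_right _ j) auv)) (by omega))
  · exact hc auuv (by omega)
  · exact commute_mk_of_mem (groupComm_mem_gam_of_le auu auv (by omega))
  · exact hc (groupComm_mem_gam auv (mem_gam_one _)) (by omega)
  · exact commute_mk_of_mem (groupComm_mem_gam_of_le auv hv (by omega))
  · exact hc avuu (by omega)
  · exact hc auvu (by omega)

theorem symb_cube {a : G} (ha : a ∈ rightEngel 3 G) (u : G) :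
    ⁅⁅⁅symb 1 a, symb 1 u⁆, symb 1 u⁆, symb 1 u⁆ = 0 := by
  have a1 := mem_gam_one a
  have hu := mem_gam_one u
  have au := groupComm_mem_gam a1 hu
  have auu := groupComm_mem_gam au hu
  rw [symb_lie a1 hu, symb_lie au hu, symb_lie auu hu,
    show groupComm (groupComm (groupComm a u) u) u = 1 from ha u, symb_one]

theorem symb_zero (x : G) : symb 0 x = 0 := symb_eq_zero (mem_gam_one x)

theorem symb_linear {a : G} (ha : a ∈ rightEngel 3 G) (u : G) (w : LowerLie G) :
    ⁅⁅⁅symb 1 a, symb 1 u⁆, symb 1 u⁆, w⁆ + ⁅⁅⁅symb 1 a, symb 1 u⁆, w⁆, symb 1 u⁆ +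
      ⁅⁅⁅symb 1 a, w⁆, symb 1 u⁆, symb 1 u⁆ = 0 := by
  induction w using LowerLie.induction with
  | zero => simp only [lie_zero, zero_lie, add_zero]
  | add v w hv hw =>
    simp only [lie_add, add_lie]
    linear_combination (norm := module) hv + hw
  | symbol j v hv =>
    rcases j with _ | _ | j
    · simp only [symb_zero, lie_zero, zero_lie, add_zero]
    · have h1 := symb_cube ha (u * v)
      have h3 := symb_cube ha (u * v⁻¹)
      rw [symb_mul (mem_gam_one u) (mem_gam_one v)] at h1
      rw [symb_mul (mem_gam_one u) (mem_gam_one v⁻¹), symb_inv (mem_gam_one v)] at h3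
      have h5 := symb_cube ha v
      simp only [lie_add, add_lie, lie_neg, neg_lie] at h1 h3
      refine LowerLie.two_torsionFree _ ?_
      linear_combination (norm := module) h1 - h3 - (2 : ℤ) • h5
    · exact symb_linear_of_two_le ha (Nat.le_add_left 2 j) u hv

theorem lieEngel_symb (hG : TwoFree (gam G 4)) {a : G} (ha : a ∈ rightEngel 3 G)
    {S : Set (LowerLie G)} (hS : ∀ s ∈ S, ∃ g, s = symb 1 g) : LieEngel S (symb 1 a) := by
  have hE : ∀ g, Commute (groupComm (groupComm a g) a) g := by
    intro g
    have h := (rightEngel_commute_conj hG ha g).2.1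
    rwa [show groupComm (g⁻¹ * a * g) a = groupComm (groupComm a g) a by
      simp only [groupComm]; group] at h
  refine ⟨?_, ?_, ?_, ?_⟩
  · set A := Subgroup.normalClosure {a} with hA
    have hA2 : ⁅⁅A, A⁆, A⁆ = ⊥ := rightEngel_normalClosure_class_two hG ha
    refine ⟨AddSubgroup.closure {z | ∃ n, ∃ y ∈ A, y ∈ gam G n ∧ z = symb n y}, ?_, ?_, ?_⟩
    · exact AddSubgroup.subset_closure ⟨1, a, Subgroup.subset_normalClosure rfl, mem_gam_one a, rfl⟩
    · intro y hy m
      induction hy using AddSubgroup.closure_induction with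
      | zero => rw [zero_lie]; exact zero_mem _
      | add x y _ _ hx hy => rw [add_lie]; exact add_mem hx hy
      | neg x _ hx => rw [neg_lie]; exact neg_mem hx
      | mem z hz =>
        obtain ⟨n, y, hyA, hyn, rfl⟩ := hz
        induction m using LowerLie.induction with
        | zero => rw [lie_zero]; exact zero_mem _
        | add x y hx hy => rw [lie_add]; exact add_mem hx hy
        | symbol k x hx =>
          rw [symb_lie hyn hx]
          exact AddSubgroup.subset_closure ⟨n + k, _, Subgroup.commutator_le_left A ⊤
            (groupComm_mem_commutator hyA trivial), groupComm_mem_gam hyn hx, rfl⟩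
    · intro y hy z hz w hw
      induction hy using AddSubgroup.closure_induction with
      | zero => simp only [zero_lie]
      | add x y _ _ hx hy => simp only [add_lie, hx, hy, add_zero]
      | neg x _ hx => simp only [neg_lie, hx, neg_zero]
      | mem y hy =>
        induction hz using AddSubgroup.closure_induction with
        | zero => simp only [lie_zero, zero_lie]
        | add x y _ _ hx hy => simp only [lie_add, add_lie, hx, hy, add_zero]
        | neg x _ hx => simp only [lie_neg, neg_lie, hx, neg_zero]
        | mem z hz =>
          induction hw using AddSubgroup.closure_induction with
          | zero => simp only [lie_zero]
          | add x y _ _ hx hy => simp only [lie_add, hx, hy, add_zero]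
          | neg x _ hx => simp only [lie_neg, hx, neg_zero]
          | mem w hw =>
            obtain ⟨i, y, hyA, hyi, rfl⟩ := hy
            obtain ⟨j, z, hzA, hzj, rfl⟩ := hz
            obtain ⟨k, w, hwA, hwk, rfl⟩ := hw
            have h1 : groupComm (groupComm y z) w ∈ ⁅⁅A, A⁆, A⁆ :=
              groupComm_mem_commutator (groupComm_mem_commutator hyA hzA) hwA
            rw [hA2, Subgroup.mem_bot] at h1
            rw [symb_lie hyi hzj, symb_lie (groupComm_mem_gam hyi hzj) hwk, h1, symb_one]
  · intro u v
    induction u using LowerLie.induction with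
    | zero => simp only [lie_zero, zero_lie, add_zero]
    | add u u' hu hu' =>
      simp only [lie_add, add_lie]
      linear_combination (norm := module) hu + hu'
    | symbol i u hu =>
      induction v using LowerLie.induction with
      | zero => simp only [lie_zero, zero_lie, add_zero]
      | add u u' hu hu' =>
        simp only [lie_add, add_lie]
        linear_combination (norm := module) hu + hu'
      | symbol j v hv =>
        rcases i with _ | i
        · simp only [symb_zero, lie_zero, zero_lie, add_zero]
        · exact symb_anti hE (Nat.le_add_left 1 i) hu hv
  · intro u hu
    obtain ⟨g, rfl⟩ := hS u hu
    exact symb_cube ha g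
  · intro u hu v
    obtain ⟨g, rfl⟩ := hS u hu
    exact symb_linear ha g v

end Linearize

section Core

variable {G : Type*} [Group G]

theorem bracketSpan_le_bot {L : Type*} [LieRing L] {S : Set L} {m : ℕ} (h : bracketSpan S m ≤ ⊥)
    (k : ℕ) : bracketSpan S (m + k) ≤ ⊥ := by
  induction k with
  | zero => exact h
  | succ k ih =>
    refine bracketSpan_succ_le (T := ∅) ?_ (by simp)
    rwa [AddSubgroup.closure_empty]

theorem lie_symb_relations (hG : TwoFree (gam G 4)) {a b c : G} (ha : a ∈ rightEngel 3 G)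
    (hb : b ∈ rightEngel 3 G) :
    bracketSpan {symb 1 a, symb 1 b, symb 1 c} 5 ≤ ⊥ ∧
      ⁅⁅⁅⁅symb 1 a, symb 1 c⁆, symb 1 b⁆, symb 1 c⁆, symb 1 c⁆ = 0 := by
  have hS : ∀ s ∈ ({symb 1 a, symb 1 b, symb 1 c} : Set (LowerLie G)), ∃ g, s = symb 1 g := by
    rintro s (rfl | rfl | rfl)
    exacts [⟨a, rfl⟩, ⟨b, rfl⟩, ⟨c, rfl⟩]
  exact LieEngel.bracketSpan_five LowerLie.two_torsionFree (lieEngel_symb hG ha hS)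
    (lieEngel_symb hG hb hS)

theorem gam_six_eq_bot (hG : TwoFree (gam G 4)) {a b c : G} (ha : a ∈ rightEngel 3 G)
    (hb : b ∈ rightEngel 3 G) (habc : Subgroup.closure {a, b, c} = ⊤) : gam G 6 = ⊥ := by
  have key : ∀ k, gam G (6 + k + 1) = ⊥ → gam G (6 + k) = ⊥ := by
    intro k hk
    rw [eq_bot_iff]
    intro x hx
    have h1 : symb (6 + k) x = 0 := by
      rw [show 6 + k = 5 + k + 1 by ring] at hx ⊢
      exact bracketSpan_le_bot (lie_symb_relations hG ha hb).1 k (symb_mem_bracketSpan habc _ hx)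
    obtain ⟨l, hl⟩ := exists_pow_mem_of_symb_eq_zero hx h1
    rw [hk, Subgroup.mem_bot] at hl
    exact hG.pow_two_pow (gam_le (by omega) hx) l hl
  obtain ⟨n, hn⟩ := exists_gam_eq_bot hG ha hb habc
  have hn6 : gam G (6 + n) = ⊥ := by
    rw [eq_bot_iff, ← hn]; exact gam_antitone (by omega)
  clear hn
  induction n with
  | zero => exact hn6
  | succ n ih => exact ih (key n hn6)

theorem engelComm_mul_eq {a b c : G} (ha : engelComm 3 a c = 1) (hb : engelComm 3 b c = 1) :
    ∃ v r : G, r ∈ gam G 4 ∧ engelComm 3 (a * b) c = v⁻¹ * groupComm r c * v ∧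
      symb 4 r = ⁅⁅⁅symb 1 a, symb 1 c⁆, symb 1 b⁆, symb 1 c⁆ := by
  have ha' : groupComm (groupComm (groupComm a c) c) c = 1 := ha
  have hb' : groupComm (groupComm (groupComm b c) c) c = 1 := hb
  have a1 := mem_gam_one a
  have b1 := mem_gam_one b
  have c1 := mem_gam_one c
  have hu := groupComm_mem_gam a1 c1
  have hs := groupComm_mem_gam hu b1
  have hs' := groupComm_mem_gam hs c1
  have hr : groupComm (groupComm (groupComm a c) c) (groupComm (groupComm a c) b * groupComm b c) ∈
      gam G 5 :=
    groupComm_mem_gam (groupComm_mem_gam hu c1)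
      (mul_mem (gam_le (by norm_num) hs) (groupComm_mem_gam b1 c1))
  have hr' : groupComm (groupComm (groupComm (groupComm a c) b) c) (groupComm b c) ∈ gam G 5 :=
    groupComm_mem_gam_succ hs' _
  refine ⟨groupComm (groupComm b c) c,
    groupComm (groupComm (groupComm a c) c) (groupComm (groupComm a c) b * groupComm b c) *
      groupComm (groupComm (groupComm a c) b) c *
      groupComm (groupComm (groupComm (groupComm a c) b) c) (groupComm b c), ?_, ?_, ?_⟩
  · exact mul_mem (mul_mem (gam_le (by norm_num) hr) hs') (gam_le (by norm_num) hr')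
  · show groupComm (groupComm (groupComm (a * b) c) c) c = _
    have e1 : groupComm (a * b) c =
        groupComm a c * groupComm (groupComm a c) b * groupComm b c := by
      simp only [groupComm]; group
    have e2 : ∀ u s v : G, groupComm (u * s * v) c = groupComm u c *
        (groupComm (groupComm u c) (s * v) * groupComm s c * groupComm (groupComm s c) v) *
        groupComm v c := by
      intro u s v; simp only [groupComm]; group
    have e3 : ∀ x y z : G, groupComm (x * y * z) c = (y * z)⁻¹ * groupComm x c * (y * z) *
        (z⁻¹ * groupComm y c * z) * groupComm z c := by
      intro x y z; simp only [groupComm]; group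
    rw [e1, e2, e3, ha', hb']
    group
  · rw [symb_mul_of_mem (mul_mem (gam_le (by norm_num) hr) hs') hr',
      symb_mul (gam_le (by norm_num) hr) hs', symb_eq_zero hr, zero_add, symb_lie a1 c1,
      symb_lie hu b1, symb_lie hs c1]

theorem engelComm_mul_mem {a b c : G} (ha : engelComm 3 a c = 1) (hb : engelComm 3 b c = 1) :
    engelComm 3 (a * b) c ∈ gam G 5 := by
  obtain ⟨v, r, hr, h, -⟩ := engelComm_mul_eq ha hb
  rw [h]
  simpa using (gam_normal 5).conj_mem _ (groupComm_mem_gam_succ hr c) v⁻¹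

theorem engelComm_mul_eq_one (hG : TwoFree (gam G 4)) {a b c : G} (ha : a ∈ rightEngel 3 G)
    (hb : b ∈ rightEngel 3 G) (habc : Subgroup.closure {a, b, c} = ⊤) :
    engelComm 3 (a * b) c = 1 := by
  obtain ⟨v, r, hr, h, hs⟩ := engelComm_mul_eq (ha c) (hb c)
  have hrc : groupComm r c ∈ gam G 5 := groupComm_mem_gam_succ hr c
  have h1 : symb 5 (groupComm r c) = 0 := by
    rw [← symb_lie hr (mem_gam_one c), hs]
    exact (lie_symb_relations hG ha hb).2
  obtain ⟨k, hk⟩ := exists_pow_mem_of_symb_eq_zero hrc h1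
  rw [gam_six_eq_bot hG ha hb habc, Subgroup.mem_bot] at hk
  rw [h, hG.pow_two_pow (gam_le (by norm_num) hrc) k hk]
  group

theorem engelComm_inv_mem {x c : G} (hx : engelComm 3 x c = 1) :
    engelComm 3 x⁻¹ c ∈ gam G 5 := by
  have hw : Commute (groupComm (groupComm x c) c) c := groupComm_eq_one_iff.1 hx
  have hu : groupComm x c ∈ gam G 2 := groupComm_mem_gam (mem_gam_one x) (mem_gam_one c)
  have hw3 : groupComm (groupComm x c) c ∈ gam G 3 := groupComm_mem_gam_succ hu c
  have e1 : engelComm 3 x⁻¹ c = x * (groupComm x c) ^ 2 *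
      groupComm (groupComm (groupComm x c) c)⁻¹
        (c * (c⁻¹ * (groupComm x c)⁻¹ ^ 2 * c * groupComm x c)) *
      (x * (groupComm x c) ^ 2)⁻¹ := by
    show groupComm (groupComm (groupComm x⁻¹ c) c) c = _
    simp only [groupComm, pow_two]; group
  rw [e1]
  refine (gam_normal 5).conj_mem _ ?_ _
  have hk : c⁻¹ * (groupComm x c)⁻¹ ^ 2 * c * groupComm x c ∈ gam G 2 := by
    refine mul_mem ?_ hu
    simpa using (gam_normal 2).conj_mem _ (pow_mem (inv_mem hu) 2) c⁻¹
  generalize c⁻¹ * (groupComm x c)⁻¹ ^ 2 * c * groupComm x c = k at hk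
  generalize groupComm (groupComm x c) c = w at *
  have e2 : groupComm w⁻¹ (c * k) = groupComm w⁻¹ k * (k⁻¹ * groupComm w⁻¹ c * k) := by
    simp only [groupComm]; group
  rw [e2, groupComm_eq_one_iff.2 hw.inv_left]
  have := groupComm_mem_gam (inv_mem hw3) hk
  simpa using this

end Core

section Reduction

variable {G : Type*} [Group G]

theorem commute_of_sq_commute (hG : TwoFree (gam G 5)) {u y : G} (hu : u ∈ gam G 4)
    (hy : y ∈ rightEngel 3 G) (h : Commute (u ^ 2) y) : Commute y u := by
  have hz : groupComm y u ∈ gam G 5 := groupComm_mem_gam (mem_gam_one y) hu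
  have h1 : u⁻¹ * groupComm y u * u = (groupComm y u)⁻¹ := by
    calc u⁻¹ * groupComm y u * u = u⁻¹ * y⁻¹ * u⁻¹ * (y * u ^ 2) := by
          simp only [groupComm, pow_two]; group
      _ = _ := by rw [← h.eq]; simp only [groupComm]; group
  have h2 : groupComm (groupComm (groupComm y u) u) u = 1 := hy u
  rw [← groupComm_eq_one_iff]
  generalize groupComm y u = z at *
  refine hG.pow_four hz ?_
  have h3 : u⁻¹ * z⁻¹ * u = z := by
    calc u⁻¹ * z⁻¹ * u = (u⁻¹ * z * u)⁻¹ := by group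
      _ = z := by rw [h1, inv_inv]
  calc z ^ 4 = (z⁻¹ * z⁻¹)⁻¹ * (z * z) := by group
    _ = (z⁻¹ * (u⁻¹ * z * u))⁻¹ * (u⁻¹ * z⁻¹ * u * (u⁻¹ * z⁻¹ * u)) := by rw [h3, h1]
    _ = (z⁻¹ * (u⁻¹ * z * u))⁻¹ * (u⁻¹ * (z⁻¹ * z⁻¹) * u) := by group
    _ = (z⁻¹ * (u⁻¹ * z * u))⁻¹ * (u⁻¹ * (z⁻¹ * (u⁻¹ * z * u)) * u) := by rw [h1]
    _ = 1 := by rw [← h2]; simp only [groupComm]; group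

theorem commute_of_pow_two_pow (hG : TwoFree (gam G 5)) {a b c : G} (ha : a ∈ rightEngel 3 G)
    (hb : b ∈ rightEngel 3 G) (habc : Subgroup.closure {a, b, c} = ⊤) {u : G} (hu : u ∈ gam G 4)
    {k : ℕ} (h : u ^ 2 ^ k = 1) : u ∈ Subgroup.center G := by
  induction k generalizing u with
  | zero => rw [pow_zero, pow_one] at h; rw [h]; exact one_mem _
  | succ k ih =>
    have h2 : u ^ 2 ∈ Subgroup.center G := by
      refine ih (pow_mem hu 2) ?_
      rwa [← pow_mul, ← pow_succ']
    have hR : ∀ y ∈ rightEngel 3 G, Commute y u := fun y hy =>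
      commute_of_sq_commute hG hu hy (Subgroup.mem_center_iff.1 h2 y).symm
    set N := Subgroup.normalClosure {a, b} with hN
    have hNu : ∀ y ∈ N, Commute y u := by
      intro y hy
      have h3 : N ≤ Subgroup.centralizer {u} := by
        rw [hN, Subgroup.normalClosure, Subgroup.closure_le]
        intro z hz
        rw [SetLike.mem_coe, Subgroup.mem_centralizer_singleton_iff]
        obtain ⟨x, hx, hxz⟩ := Group.mem_conjugatesOfSet_iff.1 hz
        obtain ⟨g, rfl⟩ := isConj_iff.1 hxz
        refine (hR _ ?_).eq
        have hx3 : x ∈ rightEngel 3 G := by rcases hx with rfl | rfl <;> assumption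
        simpa using rightEngel_conj hx3 g⁻¹
      exact Subgroup.mem_centralizer_singleton_iff.1 (h3 hy)
    have haN : a ∈ N := Subgroup.subset_normalClosure (by simp)
    have hbN : b ∈ N := Subgroup.subset_normalClosure (by simp)
    have hN2 : gam G 2 ≤ N := by
      rw [gam_succ_succ, gam_one]
      nth_rw 1 [← habc]
      nth_rw 1 [← habc]
      refine commutator_closure_le ?_
      have hX : ∀ {x : G}, x ∈ N → ∀ y, groupComm x y ∈ N ∧ groupComm y x ∈ N := fun hx y =>
        ⟨Subgroup.commutator_le_left N ⊤ (groupComm_mem_commutator hx trivial),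
          Subgroup.commutator_le_right ⊤ N (groupComm_mem_commutator trivial hx)⟩
      rintro s (rfl | rfl | rfl) t ht
      · exact (hX haN t).1
      · exact (hX hbN t).1
      · rcases ht with rfl | rfl | rfl
        · exact (hX haN s).2
        · exact (hX hbN s).2
        · rw [groupComm_eq_one_iff.2 (Commute.refl _)]
          exact one_mem _
    have hz : groupComm u c ∈ gam G 5 := groupComm_mem_gam_succ hu c
    have hcz : Commute u (groupComm u c) := (hNu _ (hN2 (gam_le (by norm_num) hz))).symm
    have hzc : groupComm u c = 1 := by
      refine hG.pow_two_pow hz (k + 1) ?_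
      have h4 : (u * groupComm u c) ^ 2 ^ (k + 1) = 1 := by
        rw [mul_groupComm]
        have h5 := conj_pow (i := 2 ^ (k + 1)) (a := c⁻¹) (b := u)
        rw [inv_inv] at h5
        rw [h5, h]; group
      rwa [hcz.mul_pow, h, one_mul] at h4
    have h6 : (⊤ : Subgroup G) ≤ Subgroup.centralizer {u} := by
      rw [← habc, Subgroup.closure_le]
      rintro s (rfl | rfl | rfl)
      · exact Subgroup.mem_centralizer_singleton_iff.2 (hR _ ha).eq
      · exact Subgroup.mem_centralizer_singleton_iff.2 (hR _ hb).eq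
      · exact Subgroup.mem_centralizer_singleton_iff.2 (groupComm_eq_one_iff.1 hzc).symm.eq
    rw [Subgroup.mem_center_iff]
    intro g
    exact Subgroup.mem_centralizer_singleton_iff.1 (h6 (Subgroup.mem_top g))

variable (G) in
/-- The subgroup of central elements of `2`-power order. -/
def twoCenter : Subgroup G where
  carrier := {z | z ∈ Subgroup.center G ∧ ∃ k : ℕ, z ^ 2 ^ k = 1}
  one_mem' := ⟨one_mem _, 0, one_pow _⟩
  mul_mem' := by
    rintro x y ⟨hx, k, hk⟩ ⟨hy, l, hl⟩
    refine ⟨mul_mem hx hy, k + l, ?_⟩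
    have hxy : Commute x y := (Subgroup.mem_center_iff.1 hx y).symm
    rw [hxy.mul_pow, pow_add, pow_mul, hk, one_pow, mul_comm, pow_mul, hl, one_pow, one_mul]
  inv_mem' := by
    rintro x ⟨hx, k, hk⟩
    exact ⟨inv_mem hx, k, by rw [inv_pow, hk, inv_one]⟩

instance twoCenter_normal : (twoCenter G).Normal where
  conj_mem x hx g := by
    rw [Subgroup.mem_center_iff.1 hx.1 g, mul_inv_cancel_right]
    exact hx

theorem gam_map {K : Type*} [Group K] (φ : G →* K) (hφ : Function.Surjective φ) (n : ℕ) :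
    (gam G n).map φ = gam K n := by
  rw [gam, Subgroup.map_lowerCentralSeries, Subgroup.map_top_of_surjective φ hφ]; rfl

theorem twoFree_quotient (hG : TwoFree (gam G 5)) {a b c : G} (ha : a ∈ rightEngel 3 G)
    (hb : b ∈ rightEngel 3 G) (habc : Subgroup.closure {a, b, c} = ⊤) :
    TwoFree (gam (G ⧸ twoCenter G) 4) := by
  intro q hq hq2
  rw [← gam_map _ (QuotientGroup.mk'_surjective (twoCenter G))] at hq
  obtain ⟨u, hu, rfl⟩ := hq
  rw [← map_pow, ← MonoidHom.mem_ker, QuotientGroup.ker_mk'] at hq2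
  obtain ⟨-, k, hk⟩ := hq2
  rw [← pow_mul, ← pow_succ'] at hk
  rw [← MonoidHom.mem_ker, QuotientGroup.ker_mk']
  exact ⟨commute_of_pow_two_pow hG ha hb habc hu hk, k + 1, hk⟩

theorem eq_one_of_map_twoCenter_eq_one (hG : TwoFree (gam G 5)) {w : G} (hw : w ∈ gam G 5)
    (h : QuotientGroup.mk' (twoCenter G) w = 1) : w = 1 := by
  rw [← MonoidHom.mem_ker, QuotientGroup.ker_mk'] at h
  obtain ⟨-, k, hk⟩ := h
  exact hG.pow_two_pow hw k hk

theorem engelComm_eq_one_of_closure (hG : TwoFree (gam G 5)) {a b c : G}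
    (ha : a ∈ rightEngel 3 G) (hb : b ∈ rightEngel 3 G)
    (habc : Subgroup.closure {a, b, c} = ⊤) :
    engelComm 3 (a * b) c = 1 ∧ engelComm 3 a⁻¹ c = 1 := by
  have hQ := twoFree_quotient hG ha hb habc
  have hs := QuotientGroup.mk'_surjective (twoCenter G)
  have ha' := rightEngel_map _ hs ha
  have hb' := rightEngel_map _ hs hb
  constructor
  · refine eq_one_of_map_twoCenter_eq_one hG (engelComm_mul_mem (ha c) (hb c)) ?_
    rw [map_engelComm, map_mul]
    refine engelComm_mul_eq_one hQ ha' hb' ?_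
    rw [← Subgroup.map_top_of_surjective _ hs, ← habc, MonoidHom.map_closure]
    simp only [Set.image_insert_eq, Set.image_singleton]
  · refine eq_one_of_map_twoCenter_eq_one hG (engelComm_inv_mem (ha c)) ?_
    rw [map_engelComm, map_inv]
    exact rightEngel_inv_of_twoFree hQ ha' _

theorem rightEngel_mul_inv (hG : TwoFree (gam G 5)) {a b : G} (ha : a ∈ rightEngel 3 G)
    (hb : b ∈ rightEngel 3 G) : a * b ∈ rightEngel 3 G ∧ a⁻¹ ∈ rightEngel 3 G := by
  have key : ∀ c, engelComm 3 (a * b) c = 1 ∧ engelComm 3 a⁻¹ c = 1 := by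
    intro c
    set H := Subgroup.closure {a, b, c} with hH
    have memH : ∀ x ∈ ({a, b, c} : Set G), x ∈ H := fun x hx => Subgroup.subset_closure hx
    let a' : H := ⟨a, memH a (by simp)⟩
    let b' : H := ⟨b, memH b (by simp)⟩
    let c' : H := ⟨c, memH c (by simp)⟩
    have down : ∀ x : H, (x : G) ∈ rightEngel 3 G → x ∈ rightEngel 3 H := by
      intro x hx g
      refine H.subtype_injective ?_
      rw [map_engelComm, map_one]
      exact hx g
    have hHG : TwoFree (gam H 5) := by
      intro u hu hu2
      refine H.subtype_injective (hG _ ?_ ?_)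
      · have h1 : H.subtype u ∈ (gam H 5).map H.subtype := ⟨u, hu, rfl⟩
        rw [gam, Subgroup.top_subtype_lowerCentralSeries] at h1
        exact Subgroup.lowerCentralSeries_mono _ le_top h1
      · rw [← map_pow, hu2, map_one]
    have hcl : Subgroup.closure {a', b', c'} = ⊤ := by
      rw [← Subgroup.closure_closure_coe_preimage (k := {a, b, c})]
      congr 1
      ext x
      simp [a', b', c', Subtype.ext_iff]
    obtain ⟨h1, h2⟩ := engelComm_eq_one_of_closure hHG (down a' ha) (down b' hb) hcl
    constructor
    · simpa using (map_engelComm H.subtype 3 (a' * b') c').symm.trans (congrArg _ h1)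
    · simpa using (map_engelComm H.subtype 3 a'⁻¹ c').symm.trans (congrArg _ h2)
  exact ⟨fun c => (key c).1, fun c => (key c).2⟩

theorem one_mem_rightEngel (n : ℕ) : (1 : G) ∈ rightEngel n G := by
  intro g
  induction n with
  | zero => rfl
  | succ n ih =>
    show groupComm (engelComm n 1 g) g = 1
    rw [ih, groupComm_eq_one_iff]
    exact Commute.one_left g

end Reduction

/-- Mathlib's lower central series is indexed from `0` (the `0`th term is `G`), so that
`γ_5(G)` is its term of index `4`. -/
theorem theorem2p2 (G : Type*) [Group G] :
    ((∀ g ∈ (⊤ : Subgroup G).lowerCentralSeries 4, orderOf g ≠ 2) →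
      IsSubgroupSet (rightEngel 3 G)) ∧
    (IsTwoPrimeGroup G → IsSubgroupSet (rightEngel 3 G)) := by
  have main : (∀ g ∈ (⊤ : Subgroup G).lowerCentralSeries 4, orderOf g ≠ 2) →
      IsSubgroupSet (rightEngel 3 G) := by
    intro h
    have hG : TwoFree (gam G 5) := by
      intro u hu hu2
      by_contra hu1
      exact h u hu (orderOf_eq_prime hu2 hu1)
    exact ⟨
      { carrier := rightEngel 3 G
        one_mem' := one_mem_rightEngel 3
        mul_mem' := fun ha hb => (rightEngel_mul_inv hG ha hb).1
        inv_mem' := fun ha => (rightEngel_mul_inv hG ha ha).2 }, rfl⟩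
  exact ⟨main, fun h => main fun g _ => h g⟩
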